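/- Let $(\Omega,\mathcal F,\mathbb P)$ be a probability space and let the process $(X_k)_{k\in\mathbb Z}$ and the filtration $(\mathcal F_k)_{k\in\mathbb Z}$ be given in one of the following two ways. (a) $(\xi_k)_{k\in\mathbb Z}$ is a stationary Markov chain on $\Omega$ with values in a measurable space $S$, with transition kernel $Q$ and marginal law $\pi$; $X_k=f(\xi_k)$, where $f:S\to\mathbb R$ satisfies $\int f^2\,d\pi<\infty$ and $\int f\,d\pi=0$; and $\mathcal F_k=\sigma(\xi_i,\ i\le k)$. (b) $T:\Omega\to\Omega$ is a bijective, bi-measurable, $\mathbb P$-preserving transformation, $\mathcal F_0\subseteq\mathcal F$ is a $\sigma$-algebra with $\mathcal F_0\subseteq T^{-1}(\mathcal F_0)$, $X_0$ is $\mathcal F_0$-measurable, square integrable and centered; $X_k=X_0\circ T^k$ and $\mathcal F_k=T^{-k}(\mathcal F_0)$. Put $S_n=\sum_{i=0}^{n-1}X_i$, $\mathbb E_0(\cdot)=\mathbb E(\cdot\mid\mathcal F_0)$ and $\|\cdot\|=\|\cdot\|_{L^2(\mathbb P)}$. Let $(b_n)_{n\ge1}$ be a nondecreasing sequence of positive reals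 that is slowly varying, i.e. $b_{\lfloor tn\rfloor}/b_n\to1$ as $n\to\infty$ for every $t>0$, and assume $$\sum_{n\ge1}\frac{b_n}{n}\Big(\sum_{k\ge n}\frac{\|\mathbb E_0(S_k)\|}{k^{3/2}}\Big)^2<\infty .$$ Then there is a (strictly) stationary sequence $(D_k)_{k\in\mathbb Z}$ of square integrable random variables such that, for every $k\in\mathbb Z$, $D_k$ is $\mathcal F_{k+1}$-measurable and $\mathbb E(D_k\mid\mathcal F_k)=0$ a.s. (in case (b) one may take $D_k=D_0\circ T^k$), so that $M_n=\sum_{i=0}^{n-1}D_i$, $n\ge0$, is a martingale with respect to $(\mathcal F_n)_{n\ge0}$, and $$\frac{S_n-M_n}{\sqrt{n\,b_n^*}}\to0\quad\text{a.s.},\qquad\text{where } b_n^*=\sum_{k=1}^n\frac1{k b_k}.$$ -/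

import Mathlib

open MeasureTheory ProbabilityTheory Filter Topology
open scoped ENNReal

namespace MartApprox

/-- A real sequence `(b n)` is slowly varying if `b ⌊t n⌋ / b n → 1` for every `t > 0`. -/
def SlowlyVarying (b : ℕ → ℝ) : Prop :=
  ∀ t : ℝ, 0 < t → Tendsto (fun n : ℕ => b ⌊t * (n : ℝ)⌋₊ / b n) atTop (𝓝 1)

/-- The normalizing sequence `b* n = ∑_{k = 1}^n 1 / (k b_k)`. -/
noncomputable def bStar (b : ℕ → ℝ) (n : ℕ) : ℝ :=
  ∑ k ∈ Finset.Icc 1 n, ((k : ℝ) * b k)⁻¹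

/-- A two-sided process is (strictly) stationary if its law, as a law on sequences indexed
by `ℤ`, is invariant under all time shifts. -/
def StationaryProcess {Ω E : Type*} [MeasurableSpace Ω] [MeasurableSpace E]
    (P : Measure Ω) (Y : ℤ → Ω → E) : Prop :=
  ∀ m : ℤ, P.map (fun (ω : Ω) (k : ℤ) => Y (k + m) ω) = P.map (fun (ω : Ω) (k : ℤ) => Y k ω)

/-- The partial sum `Y 0 + ... + Y (n - 1)`. -/
def partialSum {Ω : Type*} (Y : ℤ → Ω → ℝ) (n : ℕ) (ω : Ω) : ℝ :=
  ∑ i ∈ Finset.range n, Y (i : ℤ) ω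

/-- The tail `∑_{k ≥ n} ‖E(S_k | 𝒢)‖₂ / k ^ (3/2)`, with `S_k` the partial sums of `X`,
as an element of `[0, ∞]`. -/
noncomputable def projTail {Ω : Type*} {mΩ : MeasurableSpace Ω} (P : Measure Ω)
    (𝒢 : MeasurableSpace Ω) (X : ℤ → Ω → ℝ) (n : ℕ) : ℝ≥0∞ :=
  ∑' k : Set.Ici n,
    eLpNorm (P[partialSum X (k : ℕ) | 𝒢]) 2 P / ((k : ℕ) : ℝ≥0∞) ^ (3 / 2 : ℝ)

/-- The condition `∑_{n ≥ 1} (b_n / n) (∑_{k ≥ n} ‖E(S_k | 𝒢)‖₂ / k ^ (3/2))² < ∞`.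
All sums are taken in `[0, ∞]`. -/
def ProjectiveCondition {Ω : Type*} {mΩ : MeasurableSpace Ω} (P : Measure Ω)
    (𝒢 : MeasurableSpace Ω) (X : ℤ → Ω → ℝ) (b : ℕ → ℝ) : Prop :=
  ∑' n : Set.Ici (1 : ℕ),
    ENNReal.ofReal (b (n : ℕ) / ((n : ℕ) : ℝ)) * projTail P 𝒢 X (n : ℕ) ^ 2 < ∞

/-- The restriction of a filtration indexed by `ℤ` to the nonnegative times. -/
def nonnegTimes {Ω : Type*} {mΩ : MeasurableSpace Ω} (ℱ : Filtration ℤ mΩ) :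
    Filtration ℕ mΩ where
  seq n := ℱ (n : ℤ)
  mono' _ _ h := ℱ.mono (Int.ofNat_le.mpr h)
  le' n := ℱ.le (n : ℤ)

/-- `D` is a stationary sequence of square integrable martingale differences, `D k` being
`ℱ (k + 1)`-measurable with `E(D k | ℱ k) = 0`, for all `k : ℤ`. -/
structure StationaryMartingaleDifferences {Ω : Type*} {mΩ : MeasurableSpace Ω} (P : Measure Ω)
    (ℱ : Filtration ℤ mΩ) (D : ℤ → Ω → ℝ) : Prop where
  measurable : ∀ k : ℤ, Measurable[ℱ (k + 1)] (D k)
  memLp : ∀ k : ℤ, MemLp (D k) 2 P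
  condExp_eq_zero : ∀ k : ℤ, P[D k | ℱ k] =ᵐ[P] 0
  stationary : StationaryProcess P D

/-- With `S_n` and `M_n` the partial sums of `X` and `D`: `D` is a stationary sequence of square
integrable martingale differences, `(M_n)` is a martingale, and
`(S_n - M_n) / √(n b*_n) → 0` almost surely. -/
def IsMartingaleApproximation {Ω : Type*} {mΩ : MeasurableSpace Ω} (P : Measure Ω)
    (ℱ : Filtration ℤ mΩ) (X : ℤ → Ω → ℝ) (b : ℕ → ℝ) (D : ℤ → Ω → ℝ) : Prop :=
  StationaryMartingaleDifferences P ℱ D ∧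
  Martingale (partialSum D) (nonnegTimes ℱ) P ∧
  ∀ᵐ ω ∂P, Tendsto
    (fun n : ℕ => (partialSum X n ω - partialSum D n ω) / √((n : ℝ) * bStar b n)) atTop (𝓝 0)

section Markov

variable {Ω S : Type*} {mΩ : MeasurableSpace Ω} [mS : MeasurableSpace S]

/-- The filtration `ℱ k = σ(ξ i, i ≤ k)`. -/
def pastFiltration (ξ : ℤ → Ω → S) (hξ : ∀ i, Measurable (ξ i)) : Filtration ℤ mΩ where
  seq k := ⨆ (i : ℤ) (_ : i ≤ k), mS.comap (ξ i)
  mono' _ _ h := iSup₂_le fun i hi => le_iSup₂_of_le i (hi.trans h) le_rfl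
  le' _ := iSup₂_le fun i _ => (hξ i).comap_le

/-- `ξ` is a stationary Markov chain with transition kernel `Q`:
it is a stationary process, and `P(ξ (n + 1) ∈ A | ξ i, i ≤ n) = Q (ξ n, A)` almost surely. -/
structure StationaryMarkovChain (P : Measure Ω) (Q : Kernel S S) (ξ : ℤ → Ω → S)
    (hξ : ∀ i, Measurable (ξ i)) : Prop where
  stationary : StationaryProcess P ξ
  markov : ∀ (n : ℤ) (A : Set S), MeasurableSet A →
    P[(ξ (n + 1) ⁻¹' A).indicator (fun _ => (1 : ℝ)) | pastFiltration ξ hξ n]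
      =ᵐ[P] fun ω => (Q (ξ n ω)).real A

end Markov

section Transformation

variable {Ω : Type*} {mΩ : MeasurableSpace Ω}

/-- The iterates `T ^ k`, `k : ℤ`, of a bijective bi-measurable transformation. -/
def iter (T : Ω ≃ᵐ Ω) (k : ℤ) : Ω → Ω := ⇑((T.toEquiv : Equiv.Perm Ω) ^ k)

lemma iter_add_one (T : Ω ≃ᵐ Ω) (k : ℤ) : iter T (k + 1) = T ∘ iter T k := by
  funext ω
  simp [iter, add_comm k 1, zpow_add, Equiv.Perm.mul_apply]

lemma iter_sub_one (T : Ω ≃ᵐ Ω) (k : ℤ) : iter T (k - 1) = T.symm ∘ iter T k := by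
  have h := iter_add_one T (k - 1)
  rw [sub_add_cancel] at h
  rw [h]
  funext ω
  simp

lemma measurable_iter (T : Ω ≃ᵐ Ω) (k : ℤ) : Measurable (iter T k) := by
  induction k using Int.induction_on with
  | zero => simpa [iter] using measurable_id
  | succ i ih => rw [iter_add_one]; exact T.measurable.comp ih
  | pred i ih => rw [iter_sub_one]; exact T.symm.measurable.comp ih

/-- The filtration `ℱ k = T ^ (-k) (ℱ₀)`, consisting of the sets `(T ^ k)⁻¹(A)` with
`A ∈ ℱ₀`, where `ℱ₀ ⊆ T⁻¹(ℱ₀)`. -/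
def shiftFiltration (T : Ω ≃ᵐ Ω) (ℱ₀ : MeasurableSpace Ω) (hle : ℱ₀ ≤ mΩ)
    (hT : ℱ₀ ≤ ℱ₀.comap T) : Filtration ℤ mΩ where
  seq k := ℱ₀.comap (iter T k)
  mono' := by
    refine monotone_int_of_le_succ fun k => ?_
    rw [iter_add_one, ← MeasurableSpace.comap_comp]
    exact MeasurableSpace.comap_mono hT
  le' k := (MeasurableSpace.comap_mono hle).trans (measurable_iter T k).comap_le

end Transformation

end MartApprox

/-! Write `V` for the Koopman operator `f ↦ f ∘ T` on `L²`, `K` for `L²(ℱ₀)`, `E` for the projection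
onto `K` and `x` for `X₀`. Then `S_n = ∑_{i<n} V^i x`, the past satisfies `K ⊆ V K`, and a
martingale difference is some `V z` with `z ∈ K` and `E V z = 0`; its orbit is orthogonal.

Construction of the martingale. Let `θ_s` be the mean of `E S_i` over `i < 2^s`. Telescoping gives
`θ_s - E V θ_s = x - 2^{-s} E S_{2^s}`, so `x` is a martingale difference plus the coboundary `θ_s -
V θ_s` plus the defect `2^{-s} E S_{2^s}`. Let `t_s` be the tail of `∑ ‖E S_k‖ / k^{3/2}` from `2^s`
on. The dyadic recursion for norms (`norm_orbitSum_two_pow_le`) bounds the sums of the defect of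
length `2^r` by `56 · 2^{r/2} t_s`, for all `r`. By orthogonality the martingale differences are
then Cauchy in `s`, and the limit satisfies `‖S_{2^s} - M_{2^s}‖ ≤ 144 · 2^{s/2} t_s`
(`exists_approximation`).

From `L²` to almost sure. The hypothesis condenses to `∑ b_{2^s} t_s² < ∞`, so `R = S - M` has `∑
b_{2^j} 2^{-j} ‖R_{2^j}‖² < ∞`. Chaining through averages over dyadic blocks bounds `|R_n|` by a sum
over scales `2^j` of normalized quadratic sums of `R_{k+2^j} - R_k`. Cauchy–Schwarz with weights
`b_{2^j}` splits off `∑ 1 / b_{2^j} ≤ 2 b*_n`; the other factor is an ergodic sum, made at most `ε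
n` by Hopf's maximal lemma once low scales are dropped, and each low scale is handled by
Borel–Cantelli.

A functional of a stationary chain is carried to the shift on path space, where the result for
transformations applies. -/

namespace MartApprox

/-! ### Isometries with a past: dyadic norm inequalities -/

section Hilbert

variable {H : Type*} [NormedAddCommGroup H] [InnerProductSpace ℝ H]

/-- The operator `∑_{i < n} V ^ i`. -/
noncomputable def orbitSum (V : Module.End ℝ H) (n : ℕ) : Module.End ℝ H :=
  ∑ i ∈ Finset.range n, V ^ i

lemma orbitSum_apply (V : Module.End ℝ H) (n : ℕ) (x : H) :
    orbitSum V n x = ∑ i ∈ Finset.range n, (V ^ i) x := by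
  simp [orbitSum, LinearMap.sum_apply]

lemma orbitSum_zero (V : Module.End ℝ H) : orbitSum V 0 = 0 := by simp [orbitSum]

lemma orbitSum_one (V : Module.End ℝ H) : orbitSum V 1 = 1 := by simp [orbitSum]

lemma orbitSum_succ (V : Module.End ℝ H) (n : ℕ) (x : H) :
    orbitSum V (n + 1) x = orbitSum V n x + (V ^ n) x := by
  simp [orbitSum_apply, Finset.sum_range_succ]

lemma orbitSum_add (V : Module.End ℝ H) (m n : ℕ) (x : H) :
    orbitSum V (m + n) x = orbitSum V m x + (V ^ m) (orbitSum V n x) := by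
  simp [orbitSum_apply, Finset.sum_range_add, pow_add]

lemma orbitSum_succ' (V : Module.End ℝ H) (n : ℕ) (x : H) :
    orbitSum V (n + 1) x = x + V (orbitSum V n x) := by
  rw [add_comm, orbitSum_add, orbitSum_one]; simp

lemma orbitSum_comm (V : Module.End ℝ H) (m n : ℕ) (x : H) :
    orbitSum V m (orbitSum V n x) = orbitSum V n (orbitSum V m x) := by
  have h : Commute (orbitSum V m) (orbitSum V n) :=
    Commute.sum_left _ _ _ fun i _ => Commute.sum_right _ _ _ fun j _ => Commute.pow_pow_self V i j
  exact LinearMap.congr_fun h.eq x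

lemma orbitSum_sub_apply_self (V : Module.End ℝ H) (n : ℕ) (x : H) :
    orbitSum V n (x - V x) = x - (V ^ n) x := by
  induction n with
  | zero => simp [orbitSum_zero]
  | succ n ih => rw [orbitSum_succ, ih, map_sub, pow_succ V n]; simp

/-- `V` is an isometry and `K`, thought of as the observables of the past, satisfies
`K ⊆ V K`. -/
structure IsometricPast (V : Module.End ℝ H) (K : Submodule ℝ H) : Prop where
  inner_map : ∀ x y, inner ℝ (V x) (V y) = inner ℝ x y
  le_map : K ≤ K.map V

lemma norm_starProjection_le (K : Submodule ℝ H) [K.HasOrthogonalProjection] (y : H) :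
    ‖K.starProjection y‖ ≤ ‖y‖ :=
  (K.starProjection.le_opNorm y).trans
    (mul_le_of_le_one_left (norm_nonneg _) K.starProjection_norm_le)

lemma inner_starProjection (K : Submodule ℝ H) [K.HasOrthogonalProjection] {z : H} (hz : z ∈ K)
    (y : H) : inner ℝ z (K.starProjection y) = inner ℝ z y := by
  rw [eq_comm, ← sub_eq_zero, ← inner_sub_right]
  exact (Submodule.mem_orthogonal _ _).1 (Submodule.sub_starProjection_mem_orthogonal _) z hz

namespace IsometricPast

variable {V : Module.End ℝ H} {K : Submodule ℝ H}

lemma inner_pow_apply (h : IsometricPast V K) (n : ℕ) (x y : H) :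
    inner ℝ ((V ^ n) x) ((V ^ n) y) = inner ℝ x y := by
  induction n generalizing x y with
  | zero => simp
  | succ n ih => rw [pow_succ, Module.End.mul_apply, Module.End.mul_apply, ih, h.inner_map]

lemma norm_pow_apply (h : IsometricPast V K) (n : ℕ) (x : H) : ‖(V ^ n) x‖ = ‖x‖ := by
  rw [@norm_eq_sqrt_real_inner _ _ _ ((V ^ n) x), h.inner_pow_apply, ← norm_eq_sqrt_real_inner]

lemma norm_apply (h : IsometricPast V K) (x : H) : ‖V x‖ = ‖x‖ := by
  simpa using h.norm_pow_apply 1 x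

/-- Sums of length `n` lie in `V ^ n K`, the observables of time `n`: `K ⊆ V K` allows one more
pull-back at each step. Pairings with a vector `V ^ n y` thus reduce to pairings of `y` with `K`. -/
lemma exists_orbitSum_eq (h : IsometricPast V K) {x : H} (hx : x ∈ K) (n : ℕ) :
    ∃ z ∈ K, (V ^ n) z = orbitSum V n x := by
  induction n with
  | zero => exact ⟨0, K.zero_mem, by simp [orbitSum_zero]⟩
  | succ n ih =>
    obtain ⟨z, hz, hzx⟩ := ih
    obtain ⟨z', hz', h'⟩ := h.le_map (K.add_mem hz hx)
    refine ⟨z', hz', ?_⟩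
    rw [pow_succ, Module.End.mul_apply, h', map_add, hzx, orbitSum_succ]

lemma exists_orbitSum_apply_eq (h : IsometricPast V K) {x : H} (hx : x ∈ K) (n : ℕ) :
    ∃ z ∈ K, (V ^ n) z = orbitSum V n (V x) := by
  induction n with
  | zero => exact ⟨0, K.zero_mem, by simp [orbitSum_zero]⟩
  | succ n ih =>
    obtain ⟨z, hz, hzx⟩ := ih
    obtain ⟨z', hz', h'⟩ := h.le_map hz
    refine ⟨z' + x, K.add_mem hz' hx, ?_⟩
    rw [pow_succ, Module.End.mul_apply, map_add, map_add, h', hzx, orbitSum_succ]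

variable [K.HasOrthogonalProjection]

/-- Tower property: `y - E y` is orthogonal to `K`, so its image under `V` is orthogonal to `V K`,
which contains `K`. -/
lemma proj_apply_proj (h : IsometricPast V K) (y : H) :
    K.starProjection (V (K.starProjection y)) = K.starProjection (V y) := by
  rw [eq_comm, ← sub_eq_zero, ← map_sub, ← map_sub, Submodule.starProjection_apply_eq_zero_iff]
  intro k hk
  obtain ⟨k', hk', rfl⟩ := h.le_map hk
  rw [h.inner_map]
  exact (Submodule.mem_orthogonal _ _).1 (Submodule.sub_starProjection_mem_orthogonal y) k' hk'

lemma proj_pow_apply_proj (h : IsometricPast V K) (n : ℕ) (y : H) :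
    K.starProjection ((V ^ n) (K.starProjection y)) = K.starProjection ((V ^ n) y) := by
  induction n with
  | zero => exact K.starProjection_eq_self_iff.2 (K.starProjection_apply_mem y)
  | succ n ih =>
    rw [pow_succ', Module.End.mul_apply, Module.End.mul_apply, ← h.proj_apply_proj, ih,
      h.proj_apply_proj]

lemma norm_proj_pow_le (h : IsometricPast V K) (n : ℕ) (y : H) :
    ‖K.starProjection ((V ^ n) y)‖ ≤ ‖K.starProjection y‖ := by
  rw [← h.proj_pow_apply_proj]
  exact (norm_starProjection_le K _).trans (h.norm_pow_apply n _).le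

lemma proj_orbitSum_proj (h : IsometricPast V K) (n : ℕ) (y : H) :
    K.starProjection (orbitSum V n (K.starProjection y)) = K.starProjection (orbitSum V n y) := by
  simp [orbitSum_apply, h.proj_pow_apply_proj]

lemma norm_proj_orbitSum_le (h : IsometricPast V K) (n : ℕ) (y : H) :
    ‖K.starProjection (orbitSum V n y)‖ ≤ n * ‖K.starProjection y‖ := by
  rw [orbitSum_apply, map_sum]
  refine (norm_sum_le_of_le _ fun i _ => h.norm_proj_pow_le i y).trans ?_
  simp

/-- In `S_{2n} = S_n + V^n S_n` both terms have the same norm. Since `S_n = V^n z` with `z ∈ K`, the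
cross term is `⟨z, S_n⟩ = ⟨z, E S_n⟩ ≤ ‖S_n‖ ‖E S_n‖`; then complete the square. -/
lemma norm_orbitSum_two_mul_le (h : IsometricPast V K) {x : H} (hx : x ∈ K) (n : ℕ) :
    ‖orbitSum V (2 * n) x‖ ≤
      √2 * (‖orbitSum V n x‖ + ‖K.starProjection (orbitSum V n x)‖ / 2) := by
  obtain ⟨z, hz, hzx⟩ := h.exists_orbitSum_eq hx n
  have hin : inner ℝ (orbitSum V n x) ((V ^ n) (orbitSum V n x)) ≤
      ‖orbitSum V n x‖ * ‖K.starProjection (orbitSum V n x)‖ := by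
    have hzn : ‖orbitSum V n x‖ = ‖z‖ := by rw [← hzx, h.norm_pow_apply]
    rw [hzn]
    conv_lhs => rw [← hzx]
    rw [h.inner_pow_apply, hzx, ← inner_starProjection K hz]
    exact real_inner_le_norm _ _
  have hsq := norm_add_sq_real (orbitSum V n x) ((V ^ n) (orbitSum V n x))
  rw [h.norm_pow_apply, ← orbitSum_add, ← two_mul] at hsq
  refine le_of_sq_le_sq ?_ (by positivity)
  rw [mul_pow, Real.sq_sqrt zero_le_two, hsq]
  nlinarith [sq_nonneg ‖K.starProjection (orbitSum V n x)‖]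

lemma norm_orbitSum_two_pow_le (h : IsometricPast V K) {x : H} (hx : x ∈ K) (r : ℕ) :
    ‖orbitSum V (2 ^ r) x‖ ≤ √2 ^ r * (‖x‖ +
      ∑ j ∈ Finset.range r, ‖K.starProjection (orbitSum V (2 ^ j) x)‖ / √2 ^ j / 2) := by
  induction r with
  | zero => simp [orbitSum_one]
  | succ r ih =>
    rw [pow_succ', Finset.sum_range_succ]
    refine (h.norm_orbitSum_two_mul_le hx _).trans ?_
    calc _ ≤ √2 * (√2 ^ r * (‖x‖ +
      ∑ j ∈ Finset.range r, ‖K.starProjection (orbitSum V (2 ^ j) x)‖ / √2 ^ j / 2) +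
      ‖K.starProjection (orbitSum V (2 ^ r) x)‖ / 2) := by gcongr
      _ = _ := by
        generalize ∑ j ∈ Finset.range r, ‖K.starProjection (orbitSum V (2 ^ j) x)‖ / √2 ^ j / 2 = a
        field_simp
        ring

/-- Martingale differences are orthogonal. -/
lemma norm_orbitSum_of_proj_eq_zero (h : IsometricPast V K) {z : H} (hz : z ∈ K)
    (h0 : K.starProjection (V z) = 0) (n : ℕ) :
    ‖orbitSum V n (V z)‖ ^ 2 = n * ‖V z‖ ^ 2 := by
  induction n with
  | zero => simp [orbitSum_zero]
  | succ n ih =>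
    have hin : inner ℝ (orbitSum V n (V z)) ((V ^ n) (V z)) = 0 := by
      obtain ⟨y, hy, hyz⟩ := h.exists_orbitSum_apply_eq hz n
      rw [← hyz, h.inner_pow_apply, ← inner_starProjection K hy, h0, inner_zero_right]
    rw [orbitSum_succ, norm_add_sq_real, hin, ih, h.norm_pow_apply]
    push_cast; ring

/-- The conditional norms `‖E S_i‖` with `i ≤ m = 2 ^ s` are controlled by the tail of the series
`∑ ‖E S_k‖ / k ^ (3/2)` beyond `m`. -/
lemma norm_proj_orbitSum_le_tail (h : IsometricPast V K) (x : H) {s i : ℕ} (hi : i ≤ 2 ^ s) :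
    ‖K.starProjection (orbitSum V i x)‖ ≤ 16 * √2 ^ s * ∑ k ∈ Finset.Ico (2 ^ s) (2 ^ (s + 2)),
      ‖K.starProjection (orbitSum V k x)‖ / (k : ℝ) ^ (3 / 2 : ℝ) := by
  set e : ℕ → ℝ := fun k => ‖K.starProjection (orbitSum V k x)‖ with he
  have he0 : ∀ k, 0 ≤ e k := fun k => norm_nonneg _
  -- `E S_i = E S_{i+k} - E V^i S_k`, and the last term has norm at most `e k`.
  have h1 : ∀ k, e i ≤ e (i + k) + e k := by
    intro k
    have : K.starProjection (orbitSum V i x) = K.starProjection (orbitSum V (i + k) x)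
        - K.starProjection ((V ^ i) (orbitSum V k x)) := by
      rw [orbitSum_add, map_add]; abel
    simp only [he]
    rw [this]
    exact (norm_sub_le _ _).trans (add_le_add le_rfl (h.norm_proj_pow_le i _))
  have h4 : (2:ℕ) ^ (s + 2) = 4 * 2 ^ s := by ring
  -- Sum `h1` over `2^s ≤ k < 2 · 2^s`. As `i ≤ 2^s`, the indices `i + k` stay below `3 · 2^s`,
  -- inside the window.
  have h2 : (2 ^ s : ℝ) * e i ≤ 2 * ∑ k ∈ Finset.Ico (2 ^ s) (2 ^ (s + 2)), e k := by
    have hsum : ∑ k ∈ Finset.Ico (2 ^ s) (2 * 2 ^ s), e i ≤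
        ∑ k ∈ Finset.Ico (2 ^ s) (2 * 2 ^ s), (e (i + k) + e k) :=
      Finset.sum_le_sum fun k _ => h1 k
    rw [Finset.sum_const, Nat.card_Ico, Finset.sum_add_distrib, Finset.sum_Ico_add] at hsum
    have e1 : 2 * 2 ^ s - 2 ^ s = 2 ^ s := by omega
    rw [e1, nsmul_eq_mul] at hsum
    push_cast at hsum
    have h3 : ∑ k ∈ Finset.Ico (2 ^ s + i) (2 * 2 ^ s + i), e k ≤
        ∑ k ∈ Finset.Ico (2 ^ s) (2 ^ (s + 2)), e k :=
      Finset.sum_le_sum_of_subset_of_nonneg (Finset.Ico_subset_Ico (by omega) (by omega))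
        fun k _ _ => he0 k
    have h5 : ∑ k ∈ Finset.Ico (2 ^ s) (2 * 2 ^ s), e k ≤
        ∑ k ∈ Finset.Ico (2 ^ s) (2 ^ (s + 2)), e k :=
      Finset.sum_le_sum_of_subset_of_nonneg (Finset.Ico_subset_Ico le_rfl (by omega))
        fun k _ _ => he0 k
    linarith
  -- On the window `k^{3/2} ≤ (4 · 2^s)^{3/2} = 8 · √2^s · 2^s`; with the factor 2 of `h2` this
  -- makes 16.
  have h6 : ∑ k ∈ Finset.Ico (2 ^ s) (2 ^ (s + 2)), e k ≤
      ∑ k ∈ Finset.Ico (2 ^ s) (2 ^ (s + 2)),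
        (8 * (√2 ^ s * 2 ^ s)) * (e k / (k : ℝ) ^ (3 / 2 : ℝ)) := by
    refine Finset.sum_le_sum fun k hk => ?_
    rw [Finset.mem_Ico] at hk
    have hk0 : (0 : ℝ) < k := by
      have : 0 < 2 ^ s := by positivity
      exact_mod_cast this.trans_le hk.1
    have hpow : (k : ℝ) ^ (3 / 2 : ℝ) ≤ 8 * (√2 ^ s * 2 ^ s) := by
      have hk4 : (k : ℝ) ≤ 4 * 2 ^ s := by
        rw [h4] at hk; exact_mod_cast hk.2.le
      calc (k : ℝ) ^ (3 / 2 : ℝ) ≤ (4 * 2 ^ s : ℝ) ^ (3 / 2 : ℝ) := by gcongr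
        _ = √(4 * 2 ^ s) * (4 * 2 ^ s) := by
          rw [show (3 / 2 : ℝ) = 1 / 2 + 1 by norm_num, Real.rpow_add_one (by positivity),
            Real.sqrt_eq_rpow]
        _ = 8 * (√2 ^ s * 2 ^ s) := by
          have : √(4 * 2 ^ s : ℝ) = 2 * √2 ^ s := by
            rw [Real.sqrt_eq_iff_mul_self_eq (by positivity) (by positivity)]
            have : (√2 ^ s * √2 ^ s : ℝ) = 2 ^ s := by
              rw [← mul_pow, Real.mul_self_sqrt zero_le_two]
            linear_combination (-4) * this
          rw [this]; ring
    rw [mul_div_assoc', le_div_iff₀ (by positivity), mul_comm]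
    exact mul_le_mul_of_nonneg_right hpow (he0 k)
  rw [← Finset.mul_sum] at h6
  have hp : (0 : ℝ) < 2 ^ s := by positivity
  refine le_of_mul_le_mul_left ?_ hp
  linarith

end IsometricPast

end Hilbert

/-! ### Approximate Poisson equation and the limiting martingale difference -/

lemma sum_sqrt_two_pow_le (s : ℕ) : ∑ j ∈ Finset.range s, √2 ^ j ≤ 3 * √2 ^ s := by
  induction s with
  | zero => simp
  | succ s ih =>
    have h : (4 : ℝ) / 3 ≤ √2 := Real.le_sqrt_of_sq_le (by norm_num)
    have hp : 0 < √2 ^ s := by positivity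
    rw [Finset.sum_range_succ, pow_succ]
    nlinarith

lemma sqrt_two_pow_mul_self (s : ℕ) : √2 ^ s * √2 ^ s = (2 : ℝ) ^ s := by
  rw [← mul_pow, Real.mul_self_sqrt zero_le_two]

namespace IsometricPast

variable {H : Type*} [NormedAddCommGroup H] [InnerProductSpace ℝ H]
  {V : Module.End ℝ H} {K : Submodule ℝ H} [K.HasOrthogonalProjection]

/-- The Cesàro mean `(1 / 2 ^ s) ∑_{i < 2 ^ s} E S_i`, which serves as an approximate solution of
Poisson's equation. -/
noncomputable def poisson (V : Module.End ℝ H) (K : Submodule ℝ H) [K.HasOrthogonalProjection]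
    (x : H) (s : ℕ) : H :=
  ((2 : ℝ) ^ s)⁻¹ • ∑ i ∈ Finset.range (2 ^ s), K.starProjection (orbitSum V i x)

/-- The defect `(1 / 2 ^ s) E S_{2 ^ s}` of the approximate solution of Poisson's equation. -/
noncomputable def defect (V : Module.End ℝ H) (K : Submodule ℝ H) [K.HasOrthogonalProjection]
    (x : H) (s : ℕ) : H :=
  ((2 : ℝ) ^ s)⁻¹ • K.starProjection (orbitSum V (2 ^ s) x)

lemma poisson_mem (x : H) (s : ℕ) : poisson V K x s ∈ K :=
  K.smul_mem _ (K.sum_mem fun _ _ => K.starProjection_apply_mem _)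

lemma defect_mem (x : H) (s : ℕ) : defect V K x s ∈ K :=
  K.smul_mem _ (K.starProjection_apply_mem _)

/-- `x - defect = θ - E V θ` for `θ = poisson`. -/
lemma poisson_sub_proj (h : IsometricPast V K) {x : H} (hx : x ∈ K) (s : ℕ) :
    poisson V K x s - K.starProjection (V (poisson V K x s)) = x - defect V K x s := by
  have hstep : ∀ i, K.starProjection (V (K.starProjection (orbitSum V i x))) =
      K.starProjection (orbitSum V (i + 1) x) - x := by
    intro i
    rw [h.proj_apply_proj, orbitSum_succ', map_add, K.starProjection_eq_self_iff.2 hx,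
      add_sub_cancel_left]
  have htel : ∀ n : ℕ, ∑ i ∈ Finset.range n, K.starProjection (orbitSum V i x) -
      ∑ i ∈ Finset.range n, (K.starProjection (orbitSum V (i + 1) x) - x) =
        (n : ℝ) • x - K.starProjection (orbitSum V n x) := by
    intro n
    induction n with
    | zero => simp [orbitSum_zero]
    | succ n ih =>
      rw [Finset.sum_range_succ, Finset.sum_range_succ, add_sub_add_comm, ih]
      push_cast
      rw [add_smul, one_smul]
      abel
  have hp : ((2 : ℝ) ^ s) ≠ 0 := by positivity
  have := htel (2 ^ s)
  simp only [poisson, defect, map_smul, map_sum, hstep]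
  rw [← smul_sub, this, smul_sub, smul_smul]
  push_cast
  rw [inv_mul_cancel₀ hp, one_smul]

section Tail

variable {x : H} {t : ℕ → ℝ}

/-- `t s` dominates the tail of `∑ ‖E S_k‖ / k ^ (3/2)` beyond `2 ^ s`. -/
def TailBound (V : Module.End ℝ H) (K : Submodule ℝ H) [K.HasOrthogonalProjection]
    (x : H) (t : ℕ → ℝ) : Prop :=
  ∀ s N : ℕ, ∑ k ∈ Finset.Ico (2 ^ s) N,
    ‖K.starProjection (orbitSum V k x)‖ / (k : ℝ) ^ (3 / 2 : ℝ) ≤ t s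

lemma TailBound.nonneg (ht : TailBound V K x t) (s : ℕ) : 0 ≤ t s := by
  simpa using ht s 0

lemma TailBound.norm_proj_le (ht : TailBound V K x t) (h : IsometricPast V K) {s i : ℕ}
    (hi : i ≤ 2 ^ s) : ‖K.starProjection (orbitSum V i x)‖ ≤ 16 * √2 ^ s * t s :=
  (h.norm_proj_orbitSum_le_tail x hi).trans (mul_le_mul_of_nonneg_left (ht s _) (by positivity))

lemma TailBound.norm_poisson_le (ht : TailBound V K x t) (h : IsometricPast V K) (s : ℕ) :
    ‖poisson V K x s‖ ≤ 16 * √2 ^ s * t s := by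
  have hp : (0 : ℝ) < 2 ^ s := by positivity
  rw [poisson, norm_smul, norm_inv, norm_pow, Real.norm_ofNat, inv_mul_le_iff₀ hp]
  refine (norm_sum_le_of_le _ fun i hi => ht.norm_proj_le h (Finset.mem_range.1 hi).le).trans ?_
  simp

/-- Each term is at most 16 times the series over `[2^j, 2^(j+2))`, that is, over two consecutive
dyadic blocks. Every block is used at most twice, whence `32 = 2 · 16`. -/
lemma TailBound.sum_dyadic_le (ht : TailBound V K x t) (h : IsometricPast V K) (s r : ℕ) :
    ∑ j ∈ Finset.Ico s r, ‖K.starProjection (orbitSum V (2 ^ j) x)‖ / √2 ^ j ≤ 32 * t s := by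
  set u : ℕ → ℝ := fun k => ‖K.starProjection (orbitSum V k x)‖ / (k : ℝ) ^ (3 / 2 : ℝ) with hu
  have hcons : ∀ c r, s ≤ r → ∑ j ∈ Finset.Ico s r,
      ∑ k ∈ Finset.Ico (2 ^ (j + c)) (2 ^ (j + 1 + c)), u k
      = ∑ k ∈ Finset.Ico (2 ^ (s + c)) (2 ^ (r + c)), u k := by
    intro c r hr
    induction r, hr using Nat.le_induction with
    | base => simp
    | succ r hr ih =>
      rw [Finset.sum_Ico_succ_top hr, ih, Finset.sum_Ico_consecutive] <;>
      exact Nat.pow_le_pow_right two_pos (by omega)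
  rcases le_or_gt r s with hr | hr
  · rw [Finset.Ico_eq_empty (by omega)]
    simpa using ht.nonneg s
  have hj : ∀ j ∈ Finset.Ico s r, ‖K.starProjection (orbitSum V (2 ^ j) x)‖ / √2 ^ j ≤
      16 * (∑ k ∈ Finset.Ico (2 ^ (j + 0)) (2 ^ (j + 1 + 0)), u k +
        ∑ k ∈ Finset.Ico (2 ^ (j + 1)) (2 ^ (j + 1 + 1)), u k) := by
    intro j _
    rw [add_zero, add_zero, Finset.sum_Ico_consecutive _ (Nat.pow_le_pow_right two_pos (by omega))
      (Nat.pow_le_pow_right two_pos (by omega)), div_le_iff₀ (by positivity)]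
    refine (h.norm_proj_orbitSum_le_tail x le_rfl).trans_eq ?_
    simp only [hu]; ring
  refine (Finset.sum_le_sum hj).trans ?_
  rw [← Finset.mul_sum, Finset.sum_add_distrib, hcons 0 r hr.le, hcons 1 r hr.le]
  have h1 := ht s (2 ^ (r + 0))
  have h2 : ∑ k ∈ Finset.Ico (2 ^ (s + 1)) (2 ^ (r + 1)), u k ≤ t s := by
    refine le_trans ?_ (ht s (2 ^ (r + 1)))
    refine Finset.sum_le_sum_of_subset_of_nonneg (Finset.Ico_subset_Ico
      (Nat.pow_le_pow_right two_pos (by omega)) le_rfl) fun k _ _ => ?_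
    positivity
  simp only [add_zero] at h1 ⊢
  linarith

/-- The dyadic inequality is applied to the defect. Its norm gives 16; scales `j < s` give a
geometric sum worth `3 · 16`, scales `j ≥ s` give 32, and half of these 80 is added: `16 + 40 = 56`.
-/
lemma TailBound.norm_orbitSum_defect_le (ht : TailBound V K x t) (h : IsometricPast V K)
    (s r : ℕ) : ‖orbitSum V (2 ^ r) (defect V K x s)‖ ≤ √2 ^ r * (56 * t s) := by
  have hq : √2 ^ s * √2 ^ s = (2 : ℝ) ^ s := sqrt_two_pow_mul_self s
  have hs0 : 0 < √2 ^ s := by positivity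
  have hs1 : 1 ≤ √2 ^ s := one_le_pow₀ (Real.one_le_sqrt.2 one_le_two)
  have hp : (0 : ℝ) < 2 ^ s := by positivity
  have ht0 := ht.nonneg s
  refine (h.norm_orbitSum_two_pow_le (defect_mem x s) r).trans
    (mul_le_mul_of_nonneg_left ?_ (by positivity))
  have hY : ‖defect V K x s‖ ≤ 16 * t s := by
    rw [defect, norm_smul, norm_inv, norm_pow, Real.norm_ofNat, inv_mul_le_iff₀ hp]
    refine (ht.norm_proj_le h le_rfl).trans ?_
    rw [← hq]
    nlinarith [mul_nonneg hs0.le ht0]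
  have hE : ∀ n, K.starProjection (orbitSum V n (defect V K x s)) = ((2 : ℝ) ^ s)⁻¹ •
      K.starProjection (orbitSum V n (orbitSum V (2 ^ s) x)) := by
    intro n
    rw [defect, map_smul, map_smul, h.proj_orbitSum_proj]
  have hlow : ∀ j, ‖K.starProjection (orbitSum V (2 ^ j) (defect V K x s))‖ / √2 ^ j ≤
      √2 ^ j * (16 * t s / √2 ^ s) := by
    intro j
    rw [hE, norm_smul, norm_inv, norm_pow, Real.norm_ofNat, div_le_iff₀ (by positivity),
      inv_mul_le_iff₀ hp]
    refine (h.norm_proj_orbitSum_le _ _).trans ?_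
    have := ht.norm_proj_le h (le_refl (2 ^ s))
    calc _ ≤ ((2 ^ j : ℕ) : ℝ) * (16 * √2 ^ s * t s) := by gcongr
      _ = _ := by
        push_cast
        rw [← hq, ← sqrt_two_pow_mul_self j]
        field_simp
  -- The two sums commute, so the outer sum of length `2^s` is absorbed by the factor `2^{-s}` of
  -- the defect.
  have hhigh : ∀ j, ‖K.starProjection (orbitSum V (2 ^ j) (defect V K x s))‖ / √2 ^ j ≤
      ‖K.starProjection (orbitSum V (2 ^ j) x)‖ / √2 ^ j := by
    intro j
    gcongr
    rw [hE, norm_smul, norm_inv, norm_pow, Real.norm_ofNat, inv_mul_le_iff₀ hp, orbitSum_comm]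
    simpa using h.norm_proj_orbitSum_le (2 ^ s) (orbitSum V (2 ^ j) x)
  set v : ℕ → ℝ := fun j => ‖K.starProjection (orbitSum V (2 ^ j) (defect V K x s))‖ / √2 ^ j with hv
  have hv0 : ∀ j, 0 ≤ v j := fun j => by positivity
  have hsum : ∑ j ∈ Finset.range r, v j ≤ 80 * t s := by
    calc ∑ j ∈ Finset.range r, v j
        ≤ ∑ j ∈ Finset.range s ∪ Finset.Ico s r, v j :=
          Finset.sum_le_sum_of_subset_of_nonneg
            (fun j hj => by simp at hj ⊢; omega) fun j _ _ => hv0 j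
      _ ≤ ∑ j ∈ Finset.range s, v j + ∑ j ∈ Finset.Ico s r, v j := by
          rw [← Finset.sum_union_inter]
          exact le_add_of_nonneg_right (Finset.sum_nonneg fun j _ => hv0 j)
      _ ≤ 3 * √2 ^ s * (16 * t s / √2 ^ s) + 32 * t s := by
          refine add_le_add ?_ ((Finset.sum_le_sum fun j _ => hhigh j).trans
            (ht.sum_dyadic_le h s r))
          refine (Finset.sum_le_sum fun j _ => hlow j).trans ?_
          rw [← Finset.sum_mul]
          exact mul_le_mul_of_nonneg_right (sum_sqrt_two_pow_le s) (by positivity)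
      _ = 80 * t s := by field_simp; ring
  have : ∑ j ∈ Finset.range r, v j / 2 = (∑ j ∈ Finset.range r, v j) / 2 := by
    rw [Finset.sum_div]
  linarith

/-- The martingale difference attached to the approximate solution of Poisson's equation. -/
lemma exists_martingaleDifference (h : IsometricPast V K) (hx : x ∈ K) (s : ℕ) :
    ∃ z ∈ K, K.starProjection (V z) = 0 ∧
      x - V z = defect V K x s + (poisson V K x s - V (poisson V K x s)) := by
  -- `K ⊆ V K` lifts `E V θ` to `V y`, so that `V θ - E V θ = V (θ - y)` is the martingale part.
  obtain ⟨y, hy, hyV⟩ := h.le_map (K.starProjection_apply_mem (V (poisson V K x s)))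
  refine ⟨poisson V K x s - y, K.sub_mem (poisson_mem x s) hy, ?_, ?_⟩
  · rw [map_sub, map_sub, hyV, K.starProjection_eq_self_iff.2 (K.starProjection_apply_mem _),
      sub_self]
  · have := h.poisson_sub_proj hx s
    rw [map_sub, hyV]
    have e : x = defect V K x s + (poisson V K x s - K.starProjection (V (poisson V K x s))) := by
      rw [this]; abel
    nth_rewrite 1 [e]
    abel

lemma norm_orbitSum_eq (h : IsometricPast V K) {z : H} (hz : z ∈ K)
    (h0 : K.starProjection (V z) = 0) (r : ℕ) :
    ‖orbitSum V (2 ^ r) (V z)‖ = √2 ^ r * ‖V z‖ := by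
  rw [← sq_eq_sq₀ (norm_nonneg _) (by positivity), h.norm_orbitSum_of_proj_eq_zero hz h0, mul_pow,
    sq (√2 ^ r), sqrt_two_pow_mul_self]
  push_cast; rfl

/-- The martingale approximation in Hilbert space form. -/
theorem exists_approximation [CompleteSpace K] (h : IsometricPast V K) (hx : x ∈ K)
    (ht : TailBound V K x t) (ht0 : Tendsto t atTop (𝓝 0)) :
    ∃ z ∈ K, K.starProjection (V z) = 0 ∧
      ∀ s, ‖orbitSum V (2 ^ s) (x - V z)‖ ≤ 144 * √2 ^ s * t s := by
  choose z hzK hz0 hzd using exists_martingaleDifference h hx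
  -- The difference is again a martingale difference, so its sum of length `2^r` has norm exactly
  -- `√2^r` times its own. The coboundaries contribute a bounded amount, which vanishes after
  -- division by `√2^r` as `r → ∞`.
  have hdist : ∀ s s', ‖V (z s) - V (z s')‖ ≤ 56 * (t s + t s') := by
    intro s s'
    set θ := fun s => poisson V K x s
    have hbound : ∀ r : ℕ, ‖V (z s) - V (z s')‖ ≤
        56 * (t s + t s') + (2 * (‖θ s‖ + ‖θ s'‖)) * (√2 ^ r)⁻¹ := by
      intro r
      have hr : 0 < √2 ^ r := by positivity
      have e1 : V (z s) - V (z s') = (defect V K x s' - defect V K x s) +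
          ((θ s' - V (θ s')) - (θ s - V (θ s))) := by
        have e : V (z s) - V (z s') = (x - V (z s')) - (x - V (z s)) := by abel
        rw [e, hzd, hzd]; abel
      have e2 : orbitSum V (2 ^ r) (V (z s) - V (z s')) =
          (orbitSum V (2 ^ r) (defect V K x s') - orbitSum V (2 ^ r) (defect V K x s)) +
          ((θ s' - (V ^ 2 ^ r) (θ s')) - (θ s - (V ^ 2 ^ r) (θ s))) := by
        rw [e1, map_add, map_sub, map_sub, orbitSum_sub_apply_self, orbitSum_sub_apply_self]
      have e3 : ‖orbitSum V (2 ^ r) (V (z s) - V (z s'))‖ = √2 ^ r * ‖V (z s) - V (z s')‖ := by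
        rw [← map_sub]
        exact h.norm_orbitSum_eq (K.sub_mem (hzK s) (hzK s'))
          (by rw [map_sub, map_sub, hz0, hz0, sub_self]) r
      have e4 : √2 ^ r * ‖V (z s) - V (z s')‖ ≤
          √2 ^ r * (56 * (t s + t s')) + 2 * (‖θ s‖ + ‖θ s'‖) := by
        rw [← e3, e2]
        have i1 := ht.norm_orbitSum_defect_le h s r
        have i2 := ht.norm_orbitSum_defect_le h s' r
        have i3 := norm_add_le (orbitSum V (2 ^ r) (defect V K x s') -
          orbitSum V (2 ^ r) (defect V K x s))
          ((θ s' - (V ^ 2 ^ r) (θ s')) - (θ s - (V ^ 2 ^ r) (θ s)))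
        have i4 := norm_sub_le (orbitSum V (2 ^ r) (defect V K x s'))
          (orbitSum V (2 ^ r) (defect V K x s))
        have i5 := norm_sub_le (θ s' - (V ^ 2 ^ r) (θ s')) (θ s - (V ^ 2 ^ r) (θ s))
        have i6 := norm_sub_le (θ s') ((V ^ 2 ^ r) (θ s'))
        have i7 := norm_sub_le (θ s) ((V ^ 2 ^ r) (θ s))
        rw [h.norm_pow_apply] at i6 i7
        linarith
      rw [← mul_le_mul_iff_right₀ hr, mul_add, mul_comm (2 * _) (√2 ^ r)⁻¹,
        mul_inv_cancel_left₀ hr.ne']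
      exact e4
    have hlim : Tendsto (fun r : ℕ => 56 * (t s + t s') + (2 * (‖θ s‖ + ‖θ s'‖)) * (√2 ^ r)⁻¹)
        atTop (𝓝 (56 * (t s + t s') + (2 * (‖θ s‖ + ‖θ s'‖)) * 0)) := by
      refine tendsto_const_nhds.add (tendsto_const_nhds.mul ?_)
      exact (tendsto_pow_atTop_atTop_of_one_lt
        (Real.lt_sqrt_of_sq_lt (by norm_num))).inv_tendsto_atTop
    rw [mul_zero, add_zero] at hlim
    exact ge_of_tendsto' hlim hbound
  have hnorm : ∀ s s', ‖(⟨z s, hzK s⟩ : K) - ⟨z s', hzK s'⟩‖ ≤ 56 * (t s + t s') := by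
    intro s s'
    have : ‖z s - z s'‖ = ‖V (z s) - V (z s')‖ := by rw [← map_sub, h.norm_apply]
    calc _ = ‖z s - z s'‖ := rfl
      _ ≤ _ := this.trans_le (hdist s s')
  have hcauchy : CauchySeq fun s => (⟨z s, hzK s⟩ : K) := by
    rw [Metric.cauchySeq_iff]
    intro ε hε
    obtain ⟨N, hN⟩ := (ht0.eventually_lt_const (show 0 < ε / 112 by positivity)).exists_forall_of_atTop
    refine ⟨N, fun m hm n hn => ?_⟩
    rw [dist_eq_norm]
    have := hnorm m n
    have := hN m hm
    have := hN n hn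
    linarith
  obtain ⟨z', hz'⟩ := cauchySeq_tendsto_of_complete hcauchy
  have hzt : Tendsto z atTop (𝓝 (z' : H)) := (continuous_subtype_val.tendsto z').comp hz'
  let W : H →L[ℝ] H := V.mkContinuous 1 fun y => by rw [h.norm_apply, one_mul]
  have hVt : Tendsto (fun s => V (z s)) atTop (𝓝 (V z')) := (W.continuous.tendsto _).comp hzt
  have hz'0 : K.starProjection (V z') = 0 := by
    have h1 : Tendsto (fun s => K.starProjection (V (z s))) atTop (𝓝 (K.starProjection (V z'))) :=
      (K.starProjection.continuous.tendsto _).comp hVt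
    simp only [hz0] at h1
    exact (tendsto_nhds_unique tendsto_const_nhds h1).symm
  refine ⟨z', z'.2, hz'0, fun s => ?_⟩
  have hlim : ‖V (z s) - V z'‖ ≤ 56 * t s := by
    have h1 : Tendsto (fun s' => ‖V (z s) - V (z s')‖) atTop (𝓝 ‖V (z s) - V z'‖) :=
      (tendsto_const_nhds.sub hVt).norm
    have h2 : Tendsto (fun s' => 56 * (t s + t s')) atTop (𝓝 (56 * (t s + 0))) :=
      tendsto_const_nhds.mul (tendsto_const_nhds.add ht0)
    rw [add_zero] at h2
    exact le_of_tendsto_of_tendsto' h1 h2 (hdist s)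
  -- Three contributions, in units of `√2^s t_s`: defect 56, coboundary `2 · 16`, replacement of `z
  -- s` by its limit 56; in total 144.
  have e1 : orbitSum V (2 ^ s) (x - V z') = orbitSum V (2 ^ s) (defect V K x s) +
      (poisson V K x s - (V ^ 2 ^ s) (poisson V K x s)) +
      orbitSum V (2 ^ s) (V (z s - z')) := by
    have e : x - V z' = defect V K x s + (poisson V K x s - V (poisson V K x s)) +
        V (z s - z') := by
      rw [← hzd, map_sub]; abel
    rw [e, map_add, map_add, orbitSum_sub_apply_self]
  have i1 := ht.norm_orbitSum_defect_le h s s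
  have i2 := ht.norm_poisson_le h s
  have i3 : ‖orbitSum V (2 ^ s) (V (z s - z'))‖ ≤ √2 ^ s * (56 * t s) := by
    rw [h.norm_orbitSum_eq (K.sub_mem (hzK s) z'.2) (by rw [map_sub, map_sub, hz0, hz'0, sub_self]),
      map_sub]
    gcongr
  have i4 := norm_sub_le (poisson V K x s) ((V ^ 2 ^ s) (poisson V K x s))
  rw [h.norm_pow_apply] at i4
  have i5 := norm_add₃_le (a := orbitSum V (2 ^ s) (defect V K x s))
    (b := poisson V K x s - (V ^ 2 ^ s) (poisson V K x s)) (c := orbitSum V (2 ^ s) (V (z s - z')))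
  rw [e1]
  linarith

end Tail

end IsometricPast

/-! ### Deterministic chaining through dyadic averages -/

section Dyadic

/-- The mean of `R` over the dyadic block `[2 ^ j q, 2 ^ j (q + 1))`. -/
noncomputable def dyadicMean (R : ℕ → ℝ) (j q : ℕ) : ℝ :=
  (2 ^ j)⁻¹ * ∑ k ∈ Finset.range (2 ^ j), R (2 ^ j * q + k)

variable (R : ℕ → ℝ)

lemma dyadicMean_zero (q : ℕ) : dyadicMean R 0 q = R q := by simp [dyadicMean]

lemma dyadicMean_succ (j q : ℕ) :
    dyadicMean R (j + 1) q = (dyadicMean R j (2 * q) + dyadicMean R j (2 * q + 1)) / 2 := by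
  have h2 : 2 ^ (j + 1) = 2 ^ j + 2 ^ j := by ring
  rw [dyadicMean, h2, Finset.sum_range_add, dyadicMean, dyadicMean, pow_succ, ← mul_add]
  have e1 : ∀ k, (2 ^ j + 2 ^ j) * q + k = 2 ^ j * (2 * q) + k := fun k => by ring
  have e2 : ∀ k, 2 ^ j * (2 * q) + (2 ^ j + k) = 2 ^ j * (2 * q + 1) + k := fun k => by ring
  simp only [e1, e2]
  field_simp

/-- A block's mean differs from its parent's by half the gap between the two sibling means, and that
gap is an average of increments of step `2^j`. -/
lemma abs_dyadicMean_sub_le (j q : ℕ) :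
    |dyadicMean R j q - dyadicMean R (j + 1) (q / 2)| ≤ ((2 ^ j)⁻¹ *
      ∑ k ∈ Finset.range (2 ^ j), |R (2 ^ (j + 1) * (q / 2) + k + 2 ^ j) -
        R (2 ^ (j + 1) * (q / 2) + k)|) / 2 := by
  set p := q / 2 with hp
  have hdiff : dyadicMean R j (2 * p + 1) - dyadicMean R j (2 * p) = (2 ^ j)⁻¹ *
      ∑ k ∈ Finset.range (2 ^ j), (R (2 ^ (j + 1) * p + k + 2 ^ j) - R (2 ^ (j + 1) * p + k)) := by
    rw [dyadicMean, dyadicMean, ← mul_sub, ← Finset.sum_sub_distrib]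
    have e1 : ∀ k, 2 ^ (j + 1) * p + k = 2 ^ j * (2 * p) + k := fun k => by ring
    have e2 : ∀ k, 2 ^ j * (2 * p) + k + 2 ^ j = 2 ^ j * (2 * p + 1) + k := fun k => by ring
    simp only [e1, e2]
  have hle : |dyadicMean R j (2 * p + 1) - dyadicMean R j (2 * p)| ≤ (2 ^ j)⁻¹ *
      ∑ k ∈ Finset.range (2 ^ j), |R (2 ^ (j + 1) * p + k + 2 ^ j) - R (2 ^ (j + 1) * p + k)| := by
    rw [hdiff, abs_mul, abs_of_nonneg (by positivity : (0 : ℝ) ≤ (2 ^ j)⁻¹)]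
    exact mul_le_mul_of_nonneg_left (Finset.abs_sum_le_sum_abs _ _) (by positivity)
  rw [dyadicMean_succ]
  rcases Nat.even_or_odd' q with ⟨c, hc | hc⟩
  · have : q = 2 * p := by omega
    rw [this, show dyadicMean R j (2 * p) - (dyadicMean R j (2 * p) + dyadicMean R j (2 * p + 1)) / 2
      = -(dyadicMean R j (2 * p + 1) - dyadicMean R j (2 * p)) / 2 by ring, abs_div, abs_neg, abs_two]
    gcongr
  · have : q = 2 * p + 1 := by omega
    rw [this, show dyadicMean R j (2 * p + 1) - (dyadicMean R j (2 * p) +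
      dyadicMean R j (2 * p + 1)) / 2
      = (dyadicMean R j (2 * p + 1) - dyadicMean R j (2 * p)) / 2 by ring, abs_div, abs_two]
    gcongr

lemma dyadic_block_lt {j q r : ℕ} (hj : j < r) (hq : q < 2 ^ (r - j)) {k : ℕ} (hk : k < 2 ^ j) :
    2 ^ (j + 1) * (q / 2) + k < 2 ^ r := by
  have h1 : 2 ^ r = 2 ^ (j + 1) * 2 ^ (r - (j + 1)) := by rw [← pow_add]; congr 1; omega
  have h2 : 2 ^ (r - j) = 2 ^ (r - (j + 1)) * 2 := by rw [← pow_succ]; congr 1; omega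
  have h3 : q / 2 + 1 ≤ 2 ^ (r - (j + 1)) := by omega
  have h4 : 2 ^ j ≤ 2 ^ (j + 1) := Nat.pow_le_pow_right two_pos (by omega)
  calc 2 ^ (j + 1) * (q / 2) + k < 2 ^ (j + 1) * (q / 2 + 1) := by rw [mul_add]; omega
    _ ≤ 2 ^ r := by rw [h1]; gcongr

lemma abs_dyadicMean_sub_le_of_bound {j q r : ℕ} (hj : j < r) (hq : q < 2 ^ (r - j)) {c : ℝ}
    (hc : ∀ k < 2 ^ r, |R (k + 2 ^ j) - R k| ≤ c) :
    |dyadicMean R j q - dyadicMean R (j + 1) (q / 2)| ≤ c / 2 := by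
  refine (abs_dyadicMean_sub_le R j q).trans (div_le_div_of_nonneg_right ?_ zero_le_two)
  rw [inv_mul_le_iff₀ (by positivity)]
  refine (Finset.sum_le_sum fun k hk => hc _ (dyadic_block_lt hj hq (Finset.mem_range.1 hk))).trans ?_
  simp

/-- Cauchy–Schwarz on the block; the sum of squares is then enlarged to all of `[0, 2^r)` so that
the bound no longer depends on `q`. -/
lemma abs_dyadicMean_sub_le_sqrt {j q r : ℕ} (hj : j < r) (hq : q < 2 ^ (r - j)) :
    |dyadicMean R j q - dyadicMean R (j + 1) (q / 2)| ≤
      √((2 ^ j)⁻¹ * ∑ k ∈ Finset.range (2 ^ r), (R (k + 2 ^ j) - R k) ^ 2) / 2 := by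
  refine (abs_dyadicMean_sub_le R j q).trans (div_le_div_of_nonneg_right ?_ zero_le_two)
  refine Real.le_sqrt_of_sq_le ?_
  set a : ℕ → ℝ := fun k => |R (2 ^ (j + 1) * (q / 2) + k + 2 ^ j) - R (2 ^ (j + 1) * (q / 2) + k)|
  have hcs := sq_sum_le_card_mul_sum_sq (s := Finset.range (2 ^ j)) (f := a)
  rw [Finset.card_range] at hcs
  push_cast at hcs
  have hp : (0 : ℝ) < 2 ^ j := by positivity
  have hsub : ∑ k ∈ Finset.range (2 ^ j), a k ^ 2 ≤
      ∑ k ∈ Finset.range (2 ^ r), (R (k + 2 ^ j) - R k) ^ 2 := by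
    simp only [a, sq_abs]
    rw [← Finset.sum_image (f := fun k => (R (k + 2 ^ j) - R k) ^ 2)
      (g := fun k => 2 ^ (j + 1) * (q / 2) + k) (fun _ _ _ _ h => by simpa using h)]
    refine Finset.sum_le_sum_of_subset_of_nonneg ?_ fun k _ _ => sq_nonneg _
    intro k hk
    obtain ⟨i, hi, rfl⟩ := Finset.mem_image.1 hk
    exact Finset.mem_range.2 (dyadic_block_lt hj hq (Finset.mem_range.1 hi))
  rw [mul_pow]
  calc ((2 : ℝ) ^ j)⁻¹ ^ 2 * (∑ k ∈ Finset.range (2 ^ j), a k) ^ 2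
      ≤ ((2 : ℝ) ^ j)⁻¹ ^ 2 * (2 ^ j * ∑ k ∈ Finset.range (2 ^ j), a k ^ 2) := by gcongr
    _ = ((2 : ℝ) ^ j)⁻¹ * ∑ k ∈ Finset.range (2 ^ j), a k ^ 2 := by field_simp
    _ ≤ _ := by gcongr

lemma abs_sub_dyadicMean_le {r n : ℕ} (hn : n < 2 ^ r) {β : ℕ → ℝ}
    (hβ : ∀ j < r, ∀ q < 2 ^ (r - j), |dyadicMean R j q - dyadicMean R (j + 1) (q / 2)| ≤ β j / 2) :
    |R n - dyadicMean R r 0| ≤ (∑ j ∈ Finset.range r, β j) / 2 := by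
  have h : ∀ i ≤ r, |R n - dyadicMean R i (n / 2 ^ i)| ≤ (∑ j ∈ Finset.range i, β j) / 2 := by
    intro i hi
    induction i with
    | zero => simp [dyadicMean_zero]
    | succ i ih =>
      have hq : n / 2 ^ i < 2 ^ (r - i) := by
        rw [Nat.div_lt_iff_lt_mul (by positivity), ← pow_add]
        rwa [show r - i + i = r by omega]
      have h1 := ih (by omega)
      have h2 := hβ i (by omega) _ hq
      rw [Nat.div_div_eq_div_mul, ← pow_succ] at h2
      have h3 := abs_sub_le (R n) (dyadicMean R i (n / 2 ^ i)) (dyadicMean R (i + 1) (n / 2 ^ (i + 1)))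
      rw [Finset.sum_range_succ]
      linarith
  have := h r le_rfl
  rwa [Nat.div_eq_of_lt hn] at this

/-- Both `n` and `0` climb through their blocks to the common block `[0, 2^r)`, each at half the
cost. -/
lemma abs_sub_le_sum_dyadic {r n : ℕ} (hn : n < 2 ^ r) {β : ℕ → ℝ}
    (hβ : ∀ j < r, ∀ q < 2 ^ (r - j), |dyadicMean R j q - dyadicMean R (j + 1) (q / 2)| ≤ β j / 2) :
    |R n - R 0| ≤ ∑ j ∈ Finset.range r, β j := by
  have h1 := abs_sub_dyadicMean_le R hn hβ
  have h2 := abs_sub_dyadicMean_le R (n := 0) (by positivity) hβ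
  have h3 := abs_sub_le (R n) (dyadicMean R r 0) (R 0)
  rw [abs_sub_comm (dyadicMean R r 0)] at h3
  linarith

/-- If the dyadic increments of `R` are square summable with weights `w`, on average, then
`R n` is small with respect to `√(n ∑_{2 ^ j ≤ n} 1 / w_j)`. -/
theorem tendsto_div_sqrt_of_dyadic_increments {R : ℕ → ℝ} (hR0 : R 0 = 0) {w B : ℕ → ℝ}
    (hw : ∀ j, 0 < w j) {c : ℝ} (hc : 0 < c) (hB : ∀ n, 1 ≤ n → c ≤ B n)
    (hwB : ∀ r n, 2 ^ r ≤ n → ∑ j ∈ Finset.range (r + 1), (w j)⁻¹ ≤ 2 * B n)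
    (h1 : ∀ j, Tendsto (fun k : ℕ => (R (k + 2 ^ j) - R k) ^ 2 / (k : ℝ)) atTop (𝓝 0))
    (h2 : ∀ ε : ℝ, 0 < ε → ∃ J, ∀ N r : ℕ, ∑ k ∈ Finset.range N, ∑ j ∈ Finset.Ico J r,
      w j / 2 ^ j * (R (k + 2 ^ j) - R k) ^ 2 ≤ ε * N) :
    Tendsto (fun n : ℕ => R n / √(n * B n)) atTop (𝓝 0) := by
  -- The finitely many times before the asymptotic bound sets in are absorbed into the constant `M`.
  have hgrow : ∀ δ : ℝ, 0 < δ → ∀ j, ∃ M : ℝ, 0 ≤ M ∧ ∀ k, (R (k + 2 ^ j) - R k) ^ 2 ≤ M + δ * k := by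
    intro δ hδ j
    obtain ⟨k₀, hk₀⟩ := ((h1 j).eventually_lt_const hδ).exists_forall_of_atTop
    refine ⟨∑ k ∈ Finset.range (k₀ + 1), (R (k + 2 ^ j) - R k) ^ 2,
      Finset.sum_nonneg fun _ _ => sq_nonneg _, fun k => ?_⟩
    by_cases hk : k < k₀ + 1
    · have := Finset.single_le_sum (f := fun k => (R (k + 2 ^ j) - R k) ^ 2)
        (fun _ _ => sq_nonneg _) (Finset.mem_range.2 hk)
      have : 0 ≤ δ * k := by positivity
      linarith
    · have hk' := hk₀ k (by omega)
      rw [div_lt_iff₀ (by exact_mod_cast (by omega : 0 < k))] at hk'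
      have : 0 ≤ ∑ k ∈ Finset.range (k₀ + 1), (R (k + 2 ^ j) - R k) ^ 2 :=
        Finset.sum_nonneg fun _ _ => sq_nonneg _
      linarith
  have hsq : ∀ η : ℝ, 0 < η → ∀ᶠ n : ℕ in atTop, R n ^ 2 ≤ η * (n * B n) := by
    intro η hη
    obtain ⟨J, hJ⟩ := h2 (η / 16) (by positivity)
    -- Chosen so that `4 J² δ ≤ η c / 4`; the `+ 1` covers `J = 0`.
    set δ := η * c / (16 * (J ^ 2 + 1)) with hδ
    choose M hM0 hM using hgrow δ (by positivity)
    set M' := ∑ j ∈ Finset.range J, M j with hM'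
    have hM'0 : 0 ≤ M' := Finset.sum_nonneg fun j _ => hM0 j
    have hlarge : ∀ᶠ n : ℕ in atTop, 2 * J ^ 2 * M' ≤ η * c / 4 * n :=
      (tendsto_natCast_atTop_atTop.const_mul_atTop (by positivity)).eventually_ge_atTop _
    filter_upwards [hlarge, eventually_ge_atTop 1] with n hn hn1
    have hnpos : (0 : ℝ) < n := by exact_mod_cast hn1
    set r := Nat.log 2 n with hr
    have hrn : 2 ^ r ≤ n := Nat.pow_log_le_self 2 (by omega)
    have hnr : n < 2 ^ (r + 1) := Nat.lt_pow_succ_log_self one_lt_two n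
    have hr2 : ((2 ^ (r + 1) : ℕ) : ℝ) ≤ 2 * n := by
      rw [pow_succ]; exact_mod_cast (by omega : 2 ^ r * 2 ≤ 2 * n)
    have hBn := hB n hn1
    have hBpos : 0 < B n := hc.trans_le hBn
    set g : ℕ → ℝ := fun j =>
      √((2 ^ j)⁻¹ * ∑ k ∈ Finset.range (2 ^ (r + 1)), (R (k + 2 ^ j) - R k) ^ 2) with hg
    -- Scales below `J` use the pointwise growth bound, the others the quadratic average.
    set β : ℕ → ℝ := fun j => if j < J then √(M' + 2 * δ * n) else g j with hβ
    have hmain : |R n - R 0| ≤ ∑ j ∈ Finset.range (r + 1), β j := by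
      refine abs_sub_le_sum_dyadic R hnr fun j hj q hq => ?_
      by_cases hjJ : j < J
      · simp only [hβ, hjJ, if_true]
        refine abs_dyadicMean_sub_le_of_bound R hj hq fun k hk => Real.abs_le_sqrt ?_
        refine (hM j k).trans ?_
        have : M j ≤ M' := Finset.single_le_sum (fun j _ => hM0 j) (Finset.mem_range.2 hjJ)
        have hk2 : (k : ℝ) ≤ 2 * n := le_trans (by exact_mod_cast hk.le) hr2
        have hδ0 : 0 ≤ δ := by positivity
        nlinarith
      · simp only [hβ, hjJ, if_false]
        exact abs_dyadicMean_sub_le_sqrt R hj hq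
    have hsplit : ∑ j ∈ Finset.range (r + 1), β j ≤
        J * √(M' + 2 * δ * n) + ∑ j ∈ Finset.Ico J (r + 1), g j := by
      rw [← Finset.sum_filter_add_sum_filter_not (Finset.range (r + 1)) (fun j => j < J)]
      refine add_le_add ?_ (le_of_eq ?_)
      · calc _ = ∑ j ∈ (Finset.range (r + 1)).filter (· < J), √(M' + 2 * δ * n) :=
              Finset.sum_congr rfl fun j hj => by simp [hβ, (Finset.mem_filter.1 hj).2]
          _ ≤ ∑ j ∈ Finset.range J, √(M' + 2 * δ * n) :=
              Finset.sum_le_sum_of_subset_of_nonneg (fun j hj => by simp at hj ⊢; omega)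
                fun _ _ _ => Real.sqrt_nonneg _
          _ = _ := by simp
      · refine Finset.sum_congr (by ext j; simp; omega) fun j hj => ?_
        simp only [Finset.mem_Ico] at hj
        simp [hβ, hj.1]
    -- Cauchy–Schwarz with weights `w`: `∑ 1 / w_j ≤ 2 B n`, while `hJ` with `N = 2^(r+1) ≤ 2 n`
    -- bounds the weighted squares.
    have hcs : (∑ j ∈ Finset.Ico J (r + 1), g j) ^ 2 ≤ 2 * B n * (η / 16 * (2 * n)) := by
      have e1 : ∀ j, g j = √(w j)⁻¹ * √(w j / 2 ^ j *
          ∑ k ∈ Finset.range (2 ^ (r + 1)), (R (k + 2 ^ j) - R k) ^ 2) := by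
        intro j
        rw [← Real.sqrt_mul (inv_nonneg.2 (hw j).le)]
        simp only [hg]
        congr 1
        have := (hw j).ne'
        field_simp
      simp only [e1]
      refine (Finset.sum_mul_sq_le_sq_mul_sq _ _ _).trans ?_
      refine mul_le_mul ?_ ?_ (Finset.sum_nonneg fun _ _ => sq_nonneg _) (by positivity)
      · refine le_trans ?_ (hwB r n hrn)
        simp_rw [Real.sq_sqrt (inv_nonneg.2 (hw _).le)]
        exact Finset.sum_le_sum_of_subset_of_nonneg (fun j hj => by simp at hj ⊢; omega)
          fun j _ _ => inv_nonneg.2 (hw j).le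
      · have e2 : ∀ j, √(w j / 2 ^ j *
            ∑ k ∈ Finset.range (2 ^ (r + 1)), (R (k + 2 ^ j) - R k) ^ 2) ^ 2 =
            ∑ k ∈ Finset.range (2 ^ (r + 1)), w j / 2 ^ j * (R (k + 2 ^ j) - R k) ^ 2 := by
          intro j
          have := hw j
          rw [Real.sq_sqrt (mul_nonneg (by positivity) (Finset.sum_nonneg fun _ _ => sq_nonneg _)),
            Finset.mul_sum]
        simp only [e2]
        rw [Finset.sum_comm]
        exact (hJ _ _).trans (by gcongr)
    have hM2 : 0 ≤ M' + 2 * δ * n := by positivity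
    have hδJ : 4 * J ^ 2 * δ ≤ η * c / 4 := by
      have : δ * (16 * (J ^ 2 + 1)) = η * c := by
        rw [hδ]; field_simp
      have : 0 ≤ δ := by positivity
      nlinarith
    rw [hR0, sub_zero] at hmain
    have hfin : R n ^ 2 ≤ 2 * (J * √(M' + 2 * δ * n)) ^ 2 +
        2 * (∑ j ∈ Finset.Ico J (r + 1), g j) ^ 2 := by
      rw [← sq_abs]
      have h3 := pow_le_pow_left₀ (abs_nonneg _) (hmain.trans hsplit) 2
      nlinarith [sq_nonneg (J * √(M' + 2 * δ * n) - ∑ j ∈ Finset.Ico J (r + 1), g j)]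
    rw [mul_pow, Real.sq_sqrt hM2] at hfin
    have hηB : η * c * n ≤ η * (n * B n) := by
      rw [mul_assoc, mul_comm c]; gcongr
    have hδn : 4 * J ^ 2 * δ * n ≤ η * c / 4 * n := by gcongr
    nlinarith
  rw [Metric.tendsto_nhds]
  intro ε hε
  filter_upwards [hsq ((ε / 2) ^ 2) (by positivity), eventually_ge_atTop 1] with n hn hn1
  have hpos : 0 < n * B n := by
    have := hc.trans_le (hB n hn1)
    have : (0 : ℝ) < n := by exact_mod_cast hn1
    positivity
  have hle : |R n| ≤ ε / 2 * √(n * B n) := by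
    refine abs_le_of_sq_le_sq ?_ (by positivity)
    rwa [mul_pow, Real.sq_sqrt hpos.le]
  rw [dist_zero_right, Real.norm_eq_abs, abs_div, abs_of_nonneg (Real.sqrt_nonneg _),
    div_lt_iff₀ (Real.sqrt_pos.2 hpos)]
  have : 0 < √(n * B n) := Real.sqrt_pos.2 hpos
  nlinarith

end Dyadic

/-! ### Maximal ergodic inequalities and almost sure bounds for Birkhoff sums -/

section Maximal

variable {Ω : Type*}

/-- The maximum of the Birkhoff sums of `g` of length at most `N`. -/
noncomputable def maxBirkhoffSum (T : Ω → Ω) (g : Ω → ℝ) : ℕ → Ω → ℝ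
  | 0, _ => 0
  | N + 1, x => max 0 (g x + maxBirkhoffSum T g N (T x))

variable {T : Ω → Ω} {g : Ω → ℝ}

lemma maxBirkhoffSum_nonneg (N : ℕ) (x : Ω) : 0 ≤ maxBirkhoffSum T g N x := by
  cases N with
  | zero => exact le_rfl
  | succ N => exact le_max_left _ _

lemma maxBirkhoffSum_le_succ (N : ℕ) (x : Ω) :
    maxBirkhoffSum T g N x ≤ maxBirkhoffSum T g (N + 1) x := by
  induction N generalizing x with
  | zero => exact maxBirkhoffSum_nonneg 1 x
  | succ N ih => exact max_le_max le_rfl (add_le_add le_rfl (ih _))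

lemma birkhoffSum_le_maxBirkhoffSum {n N : ℕ} (h : n ≤ N) (x : Ω) :
    birkhoffSum T g n x ≤ maxBirkhoffSum T g N x := by
  induction n generalizing N x with
  | zero => simpa using maxBirkhoffSum_nonneg N x
  | succ n ih =>
    obtain ⟨N, rfl⟩ : ∃ M, N = M + 1 := ⟨N - 1, by omega⟩
    rw [birkhoffSum_succ']
    exact (add_le_add le_rfl (ih (by omega) _)).trans (le_max_right _ _)

variable {mΩ : MeasurableSpace Ω} {P : Measure Ω}

lemma measurable_maxBirkhoffSum (hT : Measurable T) (hg : Measurable g) (N : ℕ) :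
    Measurable (maxBirkhoffSum T g N) := by
  induction N with
  | zero => exact measurable_const
  | succ N ih => exact measurable_const.max (hg.add (ih.comp hT))

lemma integrable_maxBirkhoffSum (hT : MeasurePreserving T P P) (hg : Integrable g P) (N : ℕ) :
    Integrable (maxBirkhoffSum T g N) P := by
  induction N with
  | zero => exact integrable_zero _ _ _
  | succ N ih => exact (integrable_zero _ _ _).sup (hg.add (hT.integrable_comp_of_integrable ih))

/-- Hopf's maximal ergodic lemma. -/
lemma setIntegral_maxBirkhoffSum_pos_nonneg (hT : MeasurePreserving T P P) (hgm : Measurable g)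
    (hg : Integrable g P) (N : ℕ) :
    0 ≤ ∫ x in {x | 0 < maxBirkhoffSum T g (N + 1) x}, g x ∂P := by
  have hmeas := measurable_maxBirkhoffSum hT.measurable hgm
  have hint := integrable_maxBirkhoffSum hT hg
  have hA : MeasurableSet {x | 0 < maxBirkhoffSum T g (N + 1) x} :=
    measurableSet_lt measurable_const (hmeas _)
  have hcomp : ∫ x, maxBirkhoffSum T g N (T x) ∂P = ∫ x, maxBirkhoffSum T g N x ∂P := by
    have := integral_map (μ := P) hT.measurable.aemeasurable
      (f := maxBirkhoffSum T g N) (hmeas N).aestronglyMeasurable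
    rw [hT.map_eq] at this
    exact this.symm
  have hintT : Integrable (fun x => maxBirkhoffSum T g N (T x)) P :=
    hT.integrable_comp_of_integrable (hint N)
  rw [← integral_indicator hA]
  -- Garsia's argument: where the maximum is positive, `g` equals the integrand `M_{N+1} - M_N ∘ T`;
  -- elsewhere the integrand is nonpositive.
  calc 0 ≤ ∫ x, maxBirkhoffSum T g (N + 1) x ∂P - ∫ x, maxBirkhoffSum T g N (T x) ∂P := by
        rw [hcomp, sub_nonneg]
        exact integral_mono (hint _) (hint _) (maxBirkhoffSum_le_succ N)
    _ = ∫ x, (maxBirkhoffSum T g (N + 1) x - maxBirkhoffSum T g N (T x)) ∂P :=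
        (integral_sub (hint _) hintT).symm
    _ ≤ _ := by
        refine integral_mono ((hint _).sub hintT) (hg.indicator hA) fun x => ?_
        by_cases hx : 0 < maxBirkhoffSum T g (N + 1) x
        · rw [Set.indicator_of_mem (by exact hx)]
          have : maxBirkhoffSum T g (N + 1) x = g x + maxBirkhoffSum T g N (T x) :=
            max_eq_right ((lt_max_iff.1 hx).resolve_left (lt_irrefl _)).le
          simp only [this]; linarith
        · rw [Set.indicator_of_notMem (by exact hx)]
          have h1 := maxBirkhoffSum_nonneg (T := T) (g := g) N (T x)
          simp only
          linarith

/-- The weak type maximal inequality for Birkhoff averages. -/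
lemma measureReal_birkhoffSum_gt_le [IsProbabilityMeasure P] (hT : MeasurePreserving T P P)
    (hgm : Measurable g) (hg : Integrable g P) (hg0 : 0 ≤ g) {c : ℝ} (hc : 0 < c) (N : ℕ) :
    P.real {x | ∃ n ≤ N, c * n < birkhoffSum T g n x} ≤ (∫ x, g x ∂P) / c := by
  set g' : Ω → ℝ := fun x => g x - c with hg'
  have hgm' : Measurable g' := hgm.sub measurable_const
  have hgi' : Integrable g' P := hg.sub (integrable_const c)
  set A := {x | 0 < maxBirkhoffSum T g' (N + 1) x} with hA
  have hAm : MeasurableSet A :=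
    measurableSet_lt measurable_const (measurable_maxBirkhoffSum hT.measurable hgm' _)
  have hsub : {x | ∃ n ≤ N, c * n < birkhoffSum T g n x} ⊆ A := by
    rintro x ⟨n, hn, hx⟩
    have h1 := birkhoffSum_le_maxBirkhoffSum (T := T) (g := g') (show n ≤ N + 1 by omega) x
    have h2 : birkhoffSum T g' n x = birkhoffSum T g n x - c * n := by
      simp [birkhoffSum, hg', mul_comm]
    simp only [hA, Set.mem_ofPred_eq]
    linarith
  have hint := setIntegral_maxBirkhoffSum_pos_nonneg hT hgm' hgi' N
  rw [← hA, integral_sub hg.integrableOn (integrable_const c).integrableOn, setIntegral_const,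
    smul_eq_mul] at hint
  have h1 : ∫ x in A, g x ∂P ≤ ∫ x, g x ∂P :=
    setIntegral_le_integral hg (Eventually.of_forall hg0)
  rw [le_div_iff₀ hc]
  have h2 : P.real {x | ∃ n ≤ N, c * n < birkhoffSum T g n x} ≤ P.real A := measureReal_mono hsub
  nlinarith

/-- Borel–Cantelli: by invariance the events `(m + 1) g ∘ T^k > k` have probabilities `P((m + 1) g >
k)`, summable because `g` is integrable. -/
lemma ae_tendsto_comp_iterate_div [IsProbabilityMeasure P] (hT : MeasurePreserving T P P)
    (hgm : Measurable g) (hg : Integrable g P) (hg0 : 0 ≤ g) :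
    ∀ᵐ x ∂P, Tendsto (fun k : ℕ => g (T^[k] x) / (k : ℝ)) atTop (𝓝 0) := by
  have hev : ∀ m : ℕ, ∀ᵐ x ∂P, ∀ᶠ k : ℕ in atTop, (m + 1) * g (T^[k] x) ≤ k := by
    intro m
    have hsum : ∑' k : ℕ, P {x | (k : ℝ) < (m + 1) * g (T^[k] x)} ≠ ∞ := by
      have h1 : ∀ k : ℕ, P {x | (k : ℝ) < (m + 1) * g (T^[k] x)} =
          P {x | (m + 1) * g x ∈ Set.Ioi (k : ℝ)} := by
        intro k
        exact (hT.iterate k).measure_preimage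
          (measurableSet_lt measurable_const (measurable_const.mul hgm)).nullMeasurableSet
      simp_rw [h1]
      let _ : MeasureSpace Ω := ⟨P⟩
      have _ : IsProbabilityMeasure (volume : Measure Ω) := ‹IsProbabilityMeasure P›
      exact (tsum_prob_mem_Ioi_lt_top (X := fun x => (m + 1) * g x) (hg.const_mul _)
        fun x => mul_nonneg (by positivity) (hg0 x)).ne
    filter_upwards [ae_eventually_notMem hsum] with x hx
    filter_upwards [hx] with k hk
    simpa using hk
  filter_upwards [ae_all_iff.2 hev] with x hx
  rw [Metric.tendsto_nhds]
  intro ε hε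
  obtain ⟨m, hm⟩ := exists_nat_one_div_lt hε
  filter_upwards [hx m, eventually_ge_atTop 1] with k hk hk1
  have hk0 : (0 : ℝ) < k := by exact_mod_cast hk1
  have hg0' := hg0 (T^[k] x)
  simp only [Pi.zero_apply] at hg0'
  rw [dist_zero_right, Real.norm_eq_abs, abs_of_nonneg (by positivity), div_lt_iff₀ hk0]
  have hm1 : (0 : ℝ) < m + 1 := by positivity
  calc g (T^[k] x) ≤ 1 / (m + 1) * k := by
        rw [one_div, ← div_eq_inv_mul, le_div_iff₀ hm1]; linarith
    _ < ε * k := by gcongr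

/-- A maximal inequality along a summable family. -/
lemma ae_exists_forall_sum_le [IsProbabilityMeasure P] (hT : MeasurePreserving T P P)
    {G : ℕ → Ω → ℝ} (hGm : ∀ j, Measurable (G j)) (hGi : ∀ j, Integrable (G j) P)
    (hG0 : ∀ j, 0 ≤ G j) (hsum : Summable fun j => ∫ x, G j x ∂P) :
    ∀ᵐ x ∂P, ∀ ε : ℝ, 0 < ε → ∃ J, ∀ N r : ℕ, ∑ k ∈ Finset.range N, ∑ j ∈ Finset.Ico J r,
      G j (T^[k] x) ≤ ε * N := by
  have key : ∀ ε : ℝ, 0 < ε → ∀ᵐ x ∂P, ∃ J, ∀ N r : ℕ,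
      ∑ k ∈ Finset.range N, ∑ j ∈ Finset.Ico J r, G j (T^[k] x) ≤ ε * N := by
    intro ε hε
    set g : ℕ → ℕ → Ω → ℝ := fun J r x => ∑ j ∈ Finset.Ico J r, G j x with hg
    have hgm : ∀ J r, Measurable (g J r) := fun J r => Finset.measurable_fun_sum _ fun j _ => hGm j
    have hgi : ∀ J r, Integrable (g J r) P := fun J r => integrable_finsetSum _ fun j _ => hGi j
    have hg0 : ∀ J r, 0 ≤ g J r := fun J r x => Finset.sum_nonneg fun j _ => hG0 j x
    have hgmono : ∀ J r r' x, r ≤ r' → g J r x ≤ g J r' x := fun J r r' x h =>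
      Finset.sum_le_sum_of_subset_of_nonneg (Finset.Ico_subset_Ico le_rfl h) fun j _ _ => hG0 j x
    -- One parameter `r` serves both as time horizon and as truncation of the family, which makes
    -- the sets increasing in `r`, with a bound on their measure uniform in `r`.
    set A : ℕ → ℕ → Set Ω := fun J r => {x | ∃ n ≤ r, ε * n < birkhoffSum T (g J r) n x} with hA
    have hAmono : ∀ J, Monotone (A J) := by
      rintro J r r' h x ⟨n, hn, hx⟩
      exact ⟨n, hn.trans h, hx.trans_le (Finset.sum_le_sum fun k _ => hgmono J r r' _ h)⟩
    set τ : ℕ → ℝ := fun J => ∑' j, ∫ x, G (j + J) x ∂P with hτ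
    have hAle : ∀ J r, P (A J r) ≤ ENNReal.ofReal (τ J / ε) := by
      intro J r
      rw [← ofReal_measureReal]
      refine ENNReal.ofReal_le_ofReal ((measureReal_birkhoffSum_gt_le hT (hgm J r) (hgi J r)
        (hg0 J r) hε r).trans (div_le_div_of_nonneg_right ?_ hε.le))
      rw [integral_finsetSum _ fun j _ => hGi j, Finset.sum_Ico_eq_sum_range]
      simp_rw [add_comm J]
      exact ((summable_nat_add_iff J).2 hsum).sum_le_tsum _
        fun j _ => integral_nonneg (hG0 _)
    have hUle : ∀ J, P (⋃ r, A J r) ≤ ENNReal.ofReal (τ J / ε) := by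
      intro J
      rw [(hAmono J).measure_iUnion]
      exact iSup_le (hAle J)
    have hτ0 : Tendsto (fun J => ENNReal.ofReal (τ J / ε)) atTop (𝓝 0) := by
      have h1 : Tendsto (fun J => τ J / ε) atTop (𝓝 (0 / ε)) :=
        (tendsto_sum_nat_add fun j => ∫ x, G j x ∂P).div_const ε
      rw [zero_div] at h1
      simpa using ENNReal.tendsto_ofReal h1
    have hnull : P (⋂ J, ⋃ r, A J r) = 0 := by
      refine le_antisymm (ge_of_tendsto' hτ0 fun J => ?_) zero_le
      exact (measure_mono (Set.iInter_subset _ J)).trans (hUle J)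
    rw [ae_iff]
    refine measure_mono_null (fun x hx => ?_) hnull
    simp only [Set.mem_ofPred_eq, not_exists, not_forall, not_le] at hx
    refine Set.mem_iInter.2 fun J => ?_
    obtain ⟨N, r, h⟩ := hx J
    refine Set.mem_iUnion.2 ⟨max N r, N, le_max_left _ _, h.trans_le ?_⟩
    exact Finset.sum_le_sum fun k _ => hgmono J r _ _ (le_max_right _ _)
  have hall : ∀ᵐ x ∂P, ∀ m : ℕ, ∃ J, ∀ N r : ℕ,
      ∑ k ∈ Finset.range N, ∑ j ∈ Finset.Ico J r, G j (T^[k] x) ≤ 1 / ((m : ℝ) + 1) * N :=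
    ae_all_iff.2 fun m => key _ (by positivity)
  filter_upwards [hall] with x hx ε hε
  obtain ⟨m, hm⟩ := exists_nat_one_div_lt hε
  obtain ⟨J, hJ⟩ := hx m
  exact ⟨J, fun N r => (hJ N r).trans (by gcongr)⟩

/-- If the variances of the dyadic Birkhoff sums of `y` are summable with weights `w`, the Birkhoff
sums of `y` are almost surely negligible with respect to `√(n ∑_{2 ^ j ≤ n} 1 / w_j)`. -/
theorem ae_tendsto_birkhoffSum_div_sqrt [IsProbabilityMeasure P] (hT : MeasurePreserving T P P)
    {y : Ω → ℝ} (hym : Measurable y) (hy : MemLp y 2 P) {w B : ℕ → ℝ}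
    (hw : ∀ j, 0 < w j) {c : ℝ} (hc : 0 < c) (hB : ∀ n, 1 ≤ n → c ≤ B n)
    (hwB : ∀ r n, 2 ^ r ≤ n → ∑ j ∈ Finset.range (r + 1), (w j)⁻¹ ≤ 2 * B n)
    (hsum : Summable fun j => w j / 2 ^ j * ∫ x, birkhoffSum T y (2 ^ j) x ^ 2 ∂P) :
    ∀ᵐ x ∂P, Tendsto (fun n : ℕ => birkhoffSum T y n x / √(n * B n)) atTop (𝓝 0) := by
  have hSm : ∀ n, Measurable (birkhoffSum T y n) := fun n =>
    Finset.measurable_fun_sum _ fun k _ => hym.comp (hT.measurable.iterate k)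
  have hS2 : ∀ n, MemLp (birkhoffSum T y n) 2 P := fun n =>
    memLp_finsetSum (Finset.range n) (f := fun k x => y (T^[k] x))
      fun k _ => hy.comp_measurePreserving (hT.iterate k)
  have hsqm : ∀ n, Measurable fun x => birkhoffSum T y n x ^ 2 := fun n => (hSm n).pow_const 2
  have hsqi : ∀ n, Integrable (fun x => birkhoffSum T y n x ^ 2) P := fun n => (hS2 n).integrable_sq
  have hincr : ∀ x k j, birkhoffSum T y (k + 2 ^ j) x - birkhoffSum T y k x =
      birkhoffSum T y (2 ^ j) (T^[k] x) := fun x k j => by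
    rw [birkhoffSum_add, add_sub_cancel_left]
  have hmax := ae_exists_forall_sum_le hT
    (G := fun j x => w j / 2 ^ j * birkhoffSum T y (2 ^ j) x ^ 2)
    (fun j => (hsqm _).const_mul _) (fun j => (hsqi _).const_mul _)
    (fun j x => by have := hw j; simp only [Pi.zero_apply]; positivity)
    (by simpa only [integral_const_mul] using hsum)
  filter_upwards [hmax, ae_all_iff.2 fun j => ae_tendsto_comp_iterate_div hT (hsqm (2 ^ j))
    (hsqi (2 ^ j)) fun x => sq_nonneg _] with x hx1 hx2
  refine tendsto_div_sqrt_of_dyadic_increments (R := fun n => birkhoffSum T y n x) (birkhoffSum_zero _ _ _) hw hc hB hwB ?_ ?_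
  · simpa only [hincr] using hx2
  · simpa only [hincr] using hx1

end Maximal

/-! ### Slowly varying weights and condensation -/

section Weights

variable {b : ℕ → ℝ}

lemma bStar_nonneg_terms (hb_pos : ∀ n : ℕ, 1 ≤ n → 0 < b n) {k n : ℕ}
    (hk : k ∈ Finset.Icc 1 n) : 0 ≤ ((k : ℝ) * b k)⁻¹ := by
  have := hb_pos k (Finset.mem_Icc.1 hk).1
  positivity

lemma bStar_mono (hb_pos : ∀ n : ℕ, 1 ≤ n → 0 < b n) {m n : ℕ} (h : m ≤ n) :
    bStar b m ≤ bStar b n :=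
  Finset.sum_le_sum_of_subset_of_nonneg (Finset.Icc_subset_Icc le_rfl h)
    fun _ hk _ => bStar_nonneg_terms hb_pos hk

lemma inv_le_bStar (hb_pos : ∀ n : ℕ, 1 ≤ n → 0 < b n) {n : ℕ} (hn : 1 ≤ n) :
    (b 1)⁻¹ ≤ bStar b n := by
  refine le_trans ?_ (bStar_mono hb_pos hn)
  simp [bStar]

/-- As `b` is nondecreasing, each of the `2^r` terms of `b*` in `(2^r, 2^(r+1)]` is at least `1 /
(2^(r+1) b_{2^(r+1)})`, so the block pays for half of the new summand. -/
lemma sum_inv_dyadic_le_bStar (hb_pos : ∀ n : ℕ, 1 ≤ n → 0 < b n)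
    (hb_mono : ∀ m n : ℕ, 1 ≤ m → m ≤ n → b m ≤ b n) (r n : ℕ) (hn : 2 ^ r ≤ n) :
    ∑ j ∈ Finset.range (r + 1), (b (2 ^ j))⁻¹ ≤ 2 * bStar b n := by
  suffices h : ∑ j ∈ Finset.range (r + 1), (b (2 ^ j))⁻¹ ≤ 2 * bStar b (2 ^ r) from
    h.trans (mul_le_mul_of_nonneg_left (bStar_mono hb_pos hn) zero_le_two)
  clear hn
  induction r with
  | zero =>
    have := hb_pos 1 le_rfl
    have : 0 < (b 1)⁻¹ := by positivity
    simp [bStar]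
    linarith
  | succ r ih =>
    have h1 : 1 ≤ 2 ^ (r + 1) := Nat.one_le_two_pow
    have hbp := hb_pos _ h1
    have hle : 2 ^ r ≤ 2 ^ (r + 1) := Nat.pow_le_pow_right two_pos (by omega)
    have hdecomp : bStar b (2 ^ (r + 1)) =
        bStar b (2 ^ r) + ∑ k ∈ Finset.Ioc (2 ^ r : ℕ) (2 ^ (r + 1)), ((k : ℝ) * b k)⁻¹ := by
      have hI : ∀ m, Finset.Icc 1 m = Finset.Ioc 0 m := fun m => by ext; simp; omega
      rw [bStar, bStar, hI, hI, Finset.sum_Ioc_consecutive _ (Nat.zero_le _) hle]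
    have hblock : (b (2 ^ (r + 1)))⁻¹ / 2 ≤
        ∑ k ∈ Finset.Ioc (2 ^ r : ℕ) (2 ^ (r + 1)), ((k : ℝ) * b k)⁻¹ := by
      have hterm : ∀ k ∈ Finset.Ioc (2 ^ r : ℕ) (2 ^ (r + 1)),
          ((2 : ℝ) ^ (r + 1) * b (2 ^ (r + 1)))⁻¹ ≤ ((k : ℝ) * b k)⁻¹ := by
        intro k hk
        rw [Finset.mem_Ioc] at hk
        have hk1 : 1 ≤ k := Nat.one_le_two_pow.trans hk.1.le
        have hk0 : (0 : ℝ) < k := by exact_mod_cast hk1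
        have hbk := hb_pos k hk1
        have hkle : (k : ℝ) ≤ 2 ^ (r + 1) := by exact_mod_cast hk.2
        have := hb_mono k _ hk1 hk.2
        gcongr
      refine le_trans (le_of_eq ?_) (Finset.sum_le_sum hterm)
      rw [Finset.sum_const, Nat.card_Ioc, nsmul_eq_mul,
        show 2 ^ (r + 1) - 2 ^ r = 2 ^ r by rw [pow_succ]; omega]
      push_cast
      rw [pow_succ (2 : ℝ) r]
      field_simp
    rw [Finset.sum_range_succ, hdecomp]
    linarith

lemma SlowlyVarying.eventually_two_mul_le (hb : SlowlyVarying b)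
    (hb_pos : ∀ n : ℕ, 1 ≤ n → 0 < b n) : ∀ᶠ n : ℕ in atTop, b (2 * n) ≤ 2 * b n := by
  have h := (hb 2 two_pos).eventually_lt_const one_lt_two
  filter_upwards [h, eventually_ge_atTop 1] with n hn hn1
  have hf : ⌊(2 : ℝ) * n⌋₊ = 2 * n := by
    rw [show (2 : ℝ) * n = ((2 * n : ℕ) : ℝ) by push_cast; ring, Nat.floor_natCast]
  rw [hf, div_lt_iff₀ (hb_pos n hn1)] at hn
  exact hn.le

/-- Cauchy condensation for the projective condition. -/
lemma summable_dyadic_of_tsum_lt_top (hb_pos : ∀ n : ℕ, 1 ≤ n → 0 < b n)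
    (hb_mono : ∀ m n : ℕ, 1 ≤ m → m ≤ n → b m ≤ b n) (hb_slow : SlowlyVarying b)
    {t : ℕ → ℝ≥0∞} (ht : Antitone t)
    (h : ∑' n : Set.Ici (1 : ℕ), ENNReal.ofReal (b (n : ℕ) / ((n : ℕ) : ℝ)) * t n ^ 2 < ∞) :
    t 1 ≠ ∞ ∧ Summable fun s : ℕ => b (2 ^ s) * (t (2 ^ s)).toReal ^ 2 := by
  have hterm : ∀ n : Set.Ici (1 : ℕ),
      ENNReal.ofReal (b (n : ℕ) / ((n : ℕ) : ℝ)) * t n ^ 2 ≠ ∞ := ENNReal.ne_top_of_tsum_ne_top h.ne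
  have ht1 : t 1 ≠ ∞ := by
    intro htop
    apply hterm ⟨1, Set.mem_Ici.2 le_rfl⟩
    have := hb_pos 1 le_rfl
    simp [htop, this]
  refine ⟨ht1, ?_⟩
  have htfin : ∀ n, 1 ≤ n → t n ≠ ∞ := fun n hn => ne_top_of_le_ne_top ht1 (ht hn)
  set α : ℕ → ℝ := fun n => b n / n * (t n).toReal ^ 2 with hα
  have hα0 : ∀ n, 0 ≤ α n := by
    intro n
    rcases Nat.eq_zero_or_pos n with rfl | hn
    · simp [hα]
    · have := hb_pos n hn
      positivity
  have hαsum : Summable α := by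
    rw [tsum_subtype (Set.Ici (1 : ℕ)) fun n => ENNReal.ofReal (b n / (n : ℝ)) * t n ^ 2] at h
    have := ENNReal.summable_toReal h.ne
    refine this.congr fun n => ?_
    by_cases hn : 1 ≤ n
    · rw [Set.indicator_of_mem (by exact hn)]
      have := hb_pos n hn
      rw [ENNReal.toReal_mul, ENNReal.toReal_ofReal (by positivity), ENNReal.toReal_pow]
    · have : n = 0 := by omega
      simp [this, hα]
  have hblocks : ∀ r : ℕ, ∑ s ∈ Finset.range r, ∑ n ∈ Finset.Ico (2 ^ s) (2 ^ (s + 1)), α n =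
      ∑ n ∈ Finset.Ico 1 (2 ^ r), α n := by
    intro r
    induction r with
    | zero => simp
    | succ r ih =>
      rw [Finset.sum_range_succ, ih, Finset.sum_Ico_consecutive _ Nat.one_le_two_pow
        (Nat.pow_le_pow_right two_pos (by omega))]
  -- Monotonicity on a block compares `b` at its left end with `t` at its right end; the doubling
  -- bound for `b` later realigns the two.
  have hshift : Summable fun s : ℕ => b (2 ^ s) * (t (2 ^ (s + 1))).toReal ^ 2 := by
    refine summable_of_sum_range_le (c := 2 * ∑' n, α n) (fun s => ?_) fun r => ?_
    · have := hb_pos (2 ^ s) Nat.one_le_two_pow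
      positivity
    · have hblock : ∀ s, b (2 ^ s) * (t (2 ^ (s + 1))).toReal ^ 2 ≤
          2 * ∑ n ∈ Finset.Ico (2 ^ s) (2 ^ (s + 1)), α n := by
        intro s
        have hbs := hb_pos (2 ^ s) Nat.one_le_two_pow
        have hn : ∀ n ∈ Finset.Ico (2 ^ s) (2 ^ (s + 1)),
            b (2 ^ s) / 2 ^ (s + 1) * (t (2 ^ (s + 1))).toReal ^ 2 ≤ α n := by
          intro n hn
          rw [Finset.mem_Ico] at hn
          have hn1 : 1 ≤ n := Nat.one_le_two_pow.trans hn.1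
          have hn0 : (0 : ℝ) < n := by exact_mod_cast hn1
          have hnle : (n : ℝ) ≤ 2 ^ (s + 1) := by exact_mod_cast hn.2.le
          have h1 := hb_mono _ n Nat.one_le_two_pow hn.1
          have h2 : (t (2 ^ (s + 1))).toReal ≤ (t n).toReal :=
            ENNReal.toReal_mono (htfin n hn1) (ht hn.2.le)
          have := hb_pos n hn1
          simp only [hα]
          gcongr
        have := Finset.sum_le_sum hn
        rw [Finset.sum_const, Nat.card_Ico, nsmul_eq_mul,
          show 2 ^ (s + 1) - 2 ^ s = 2 ^ s by rw [pow_succ]; omega] at this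
        push_cast at this
        have e : (2 : ℝ) ^ s * (b (2 ^ s) / 2 ^ (s + 1) * (t (2 ^ (s + 1))).toReal ^ 2) =
            b (2 ^ s) * (t (2 ^ (s + 1))).toReal ^ 2 / 2 := by
          rw [pow_succ (2 : ℝ) s]; field_simp
        rw [e] at this
        linarith
      refine (Finset.sum_le_sum fun s _ => hblock s).trans ?_
      rw [← Finset.mul_sum, hblocks]
      exact mul_le_mul_of_nonneg_left (hαsum.sum_le_tsum _ fun n _ => hα0 n) zero_le_two
  rw [← summable_nat_add_iff 1]
  refine Summable.of_norm_bounded_eventually_nat (hshift.mul_left 2) ?_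
  have hpow : Tendsto (fun s : ℕ => 2 ^ s) atTop atTop := tendsto_pow_atTop_atTop_of_one_lt one_lt_two
  filter_upwards [hpow.eventually (hb_slow.eventually_two_mul_le hb_pos)] with s hs
  rw [← pow_succ'] at hs
  have := hb_pos (2 ^ (s + 1)) Nat.one_le_two_pow
  rw [Real.norm_of_nonneg (by positivity), ← mul_assoc]
  gcongr

end Weights

/-! ### Koopman operator and conditional expectation on `L²` -/

section Lp

variable {Ω : Type*} {mΩ : MeasurableSpace Ω} {P : Measure Ω}

lemma projTail_antitone (𝒢 : MeasurableSpace Ω) (X : ℤ → Ω → ℝ) : Antitone (projTail P 𝒢 X) := by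
  intro m n h
  exact ENNReal.tsum_mono_subtype
    (fun k : ℕ => eLpNorm (P[partialSum X k | 𝒢]) 2 P / (k : ℝ≥0∞) ^ (3 / 2 : ℝ))
    (Set.Ici_subset_Ici.2 h)

/-- The Koopman operator of a measure preserving map, on real `L²`. -/
noncomputable def koopman {T : Ω → Ω} (hT : MeasurePreserving T P P) :
    Module.End ℝ (Lp ℝ 2 P) :=
  (Lp.compMeasurePreservingₗᵢ ℝ T hT).toLinearMap

lemma koopman_coeFn {T : Ω → Ω} (hT : MeasurePreserving T P P) (f : Lp ℝ 2 P) :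
    ⇑(koopman hT f) =ᵐ[P] f ∘ T :=
  Lp.coeFn_compMeasurePreserving f hT

lemma koopman_pow_coeFn {T : Ω → Ω} (hT : MeasurePreserving T P P) (f : Lp ℝ 2 P) (n : ℕ) :
    ⇑((koopman hT ^ n) f) =ᵐ[P] f ∘ T^[n] := by
  induction n with
  | zero => simp
  | succ n ih =>
    rw [pow_succ', Module.End.mul_apply, Function.iterate_succ, ← Function.comp_assoc]
    exact (koopman_coeFn hT _).trans (hT.quasiMeasurePreserving.ae_eq_comp ih)

lemma orbitSum_koopman_coeFn {T : Ω → Ω} (hT : MeasurePreserving T P P) {f : Lp ℝ 2 P}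
    {g : Ω → ℝ} (h : f =ᵐ[P] g) (n : ℕ) :
    ⇑(orbitSum (koopman hT) n f) =ᵐ[P] birkhoffSum T g n := by
  induction n with
  | zero => rw [orbitSum_zero]; simpa using Lp.coeFn_zero ℝ 2 P
  | succ n ih =>
    rw [orbitSum_succ]
    refine (Lp.coeFn_add _ _).trans ?_
    have h2 := (koopman_pow_coeFn hT f n).trans ((hT.iterate n).quasiMeasurePreserving.ae_eq_comp h)
    filter_upwards [ih, h2] with x h1 h2
    rw [Pi.add_apply, h1, h2, birkhoffSum_succ, Function.comp_apply]

lemma norm_sq_eq_integral {f : Lp ℝ 2 P} {g : Ω → ℝ} (h : f =ᵐ[P] g) :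
    ‖f‖ ^ 2 = ∫ x, g x ^ 2 ∂P := by
  rw [← real_inner_self_eq_norm_sq, L2.inner_def]
  refine integral_congr_ae ?_
  filter_upwards [h] with x hx
  rw [hx]
  simp [sq]

lemma starProjection_lpMeas_coeFn {Ω : Type*} {𝒢 mΩ : MeasurableSpace Ω} {P : Measure Ω}
    [IsFiniteMeasure P] (hle : 𝒢 ≤ mΩ)
    [(lpMeas ℝ ℝ 𝒢 2 P).HasOrthogonalProjection] {f : Lp ℝ 2 P} {g : Ω → ℝ} (h : f =ᵐ[P] g) :
    ⇑((lpMeas ℝ ℝ 𝒢 2 P).starProjection f) =ᵐ[P] P[g | 𝒢] := by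
  have hg : MemLp g 2 P := (memLp_congr_ae h).1 (Lp.memLp f)
  have hfg : f = hg.toLp g := by
    apply Lp.ext
    exact h.trans hg.coeFn_toLp.symm
  have := hg.condExpL2_ae_eq_condExp (𝕜 := ℝ) hle
  rw [← hfg] at this
  exact this

/-- Conditional expectation commutes with a measure preserving change of variables. -/
lemma condExp_comp_comap {Ω' : Type*} {m mΩ' : MeasurableSpace Ω'} {P' : Measure Ω'}
    [IsFiniteMeasure P] [IsFiniteMeasure P'] {φ : Ω → Ω'} (hφ : MeasurePreserving φ P P')
    (hm : m ≤ mΩ') {Y : Ω' → ℝ} (hY : Integrable Y P') :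
    P[Y ∘ φ | m.comap φ] =ᵐ[P] P'[Y | m] ∘ φ := by
  have hm' : m.comap φ ≤ mΩ := (MeasurableSpace.comap_mono hm).trans hφ.measurable.comap_le
  symm
  refine ae_eq_condExp_of_forall_setIntegral_eq hm' (hφ.integrable_comp_of_integrable hY)
    (fun s _ _ => (hφ.integrable_comp_of_integrable integrable_condExp).integrableOn) ?_ ?_
  · rintro _ ⟨s, hs, rfl⟩ _
    have hset : ∀ {Z : Ω' → ℝ}, Integrable Z P' →
        ∫ x in φ ⁻¹' s, (Z ∘ φ) x ∂P = ∫ x in s, Z x ∂P' := by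
      intro Z hZ
      rw [← hφ.map_eq] at hZ ⊢
      rw [setIntegral_map (hm s hs) hZ.aestronglyMeasurable hφ.measurable.aemeasurable]
      rfl
    rw [hset integrable_condExp, hset hY]
    exact setIntegral_condExp hm hY hs
  · exact (stronglyMeasurable_condExp.comp_measurable
      (comap_measurable φ)).aestronglyMeasurable

end Lp

/-! ### Martingales from stationary differences, and integer iterates -/

section Martingale

variable {Ω : Type*} {mΩ : MeasurableSpace Ω} {P : Measure Ω}

lemma StationaryMartingaleDifferences.martingale [IsProbabilityMeasure P] {ℱ : Filtration ℤ mΩ}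
    {D : ℤ → Ω → ℝ} (h : StationaryMartingaleDifferences P ℱ D) :
    Martingale (partialSum D) (nonnegTimes ℱ) P := by
  refine martingale_of_condExp_sub_eq_zero_nat (fun n => ?_) (fun n => ?_) fun n => ?_
  · refine Measurable.stronglyMeasurable (Finset.measurable_fun_sum _ fun i hi => ?_)
    refine (h.measurable i).mono (ℱ.mono ?_) le_rfl
    have := Finset.mem_range.1 hi
    omega
  · exact integrable_finsetSum (Finset.range n) (f := fun (i : ℕ) ω => D i ω)
      fun i _ => (h.memLp i).integrable one_le_two
  · have : partialSum D (n + 1) - partialSum D n = D n := by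
      funext ω
      simp [partialSum, Finset.sum_range_succ]
    rw [this]
    exact h.condExp_eq_zero n

end Martingale

section Iterates

variable {Ω : Type*} {mΩ : MeasurableSpace Ω}

lemma iter_zero (T : Ω ≃ᵐ Ω) : iter T 0 = id := by
  funext ω; simp [iter]

lemma iter_natCast (T : Ω ≃ᵐ Ω) (n : ℕ) : iter T (n : ℤ) = T^[n] := by
  induction n with
  | zero => exact iter_zero T
  | succ n ih => rw [Nat.cast_succ, iter_add_one, ih, ← Function.iterate_succ']

lemma iter_add_apply (T : Ω ≃ᵐ Ω) (k m : ℤ) (ω : Ω) : iter T (k + m) ω = iter T k (iter T m ω) := by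
  simp [iter, zpow_add, Equiv.Perm.mul_apply]

lemma measurePreserving_iter {P : Measure Ω} {T : Ω ≃ᵐ Ω} (hT : MeasurePreserving T P P) (k : ℤ) :
    MeasurePreserving (iter T k) P P := by
  induction k using Int.induction_on with
  | zero => rw [iter_zero]; exact MeasurePreserving.id P
  | succ i ih => rw [iter_add_one]; exact hT.comp ih
  | pred i ih => rw [iter_sub_one]; exact (hT.symm T).comp ih

lemma partialSum_iter (T : Ω ≃ᵐ Ω) (g : Ω → ℝ) (n : ℕ) :
    partialSum (fun i ω => g (iter T i ω)) n = birkhoffSum T g n := by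
  funext ω
  simp only [partialSum, birkhoffSum, iter_natCast]

lemma stationaryProcess_iter {P : Measure Ω} {T : Ω ≃ᵐ Ω} (hT : MeasurePreserving T P P)
    {g : Ω → ℝ} (hg : Measurable g) : StationaryProcess P fun k ω => g (iter T k ω) := by
  intro m
  have hF : Measurable fun (ω : Ω) (k : ℤ) => g (iter T k ω) :=
    measurable_pi_lambda _ fun k => hg.comp (measurable_iter T k)
  have h := Measure.map_map (μ := P) hF (measurable_iter T m)
  rw [(measurePreserving_iter hT m).map_eq] at h
  rw [h]
  congr 1
  funext ω k
  simp only [Function.comp_apply, iter_add_apply]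

end Iterates

/-! ### The theorem for measure preserving transformations -/

section L2

/-- The preimage of `f ∈ K` under the Koopman operator is `f ∘ T⁻¹`, which is `ℱ₀`-measurable
because every set of `ℱ₀` is `T⁻¹(A)` with `A ∈ ℱ₀`. -/
lemma isometricPast_koopman {Ω : Type*} {ℱ₀ mΩ : MeasurableSpace Ω} {P : Measure Ω} {T : Ω ≃ᵐ Ω}
    (hT : MeasurePreserving T P P) (hℱ : ℱ₀ ≤ ℱ₀.comap T) :
    IsometricPast (koopman hT) (lpMeas ℝ ℝ ℱ₀ 2 P) where
  inner_map x y := LinearIsometry.inner_map_map (Lp.compMeasurePreservingₗᵢ ℝ T hT) x y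
  le_map := by
    intro f hf
    obtain ⟨g, hg, hfg⟩ := mem_lpMeas_iff_aestronglyMeasurable.1 hf
    have hTs : MeasurePreserving T.symm P P := hT.symm T
    have hgT : StronglyMeasurable[ℱ₀] (g ∘ T.symm) := by
      refine Measurable.stronglyMeasurable fun s hs => ?_
      obtain ⟨A, hA, hAs⟩ := hℱ _ (hg.measurable hs)
      rw [Set.preimage_comp, ← hAs, ← Set.preimage_comp]
      convert hA
      simp
    have hmem : MemLp (g ∘ T.symm) 2 P :=
      ((memLp_congr_ae hfg).1 (Lp.memLp f)).comp_measurePreserving hTs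
    refine ⟨hmem.toLp _, mem_lpMeas_iff_aestronglyMeasurable.2 ⟨_, hgT, hmem.coeFn_toLp⟩, ?_⟩
    apply Lp.ext
    refine (koopman_coeFn hT _).trans ?_
    refine (hT.quasiMeasurePreserving.ae_eq_comp hmem.coeFn_toLp).trans ?_
    refine EventuallyEq.trans (Eventually.of_forall fun ω => ?_) hfg.symm
    simp

lemma tailBound_of_projTail {Ω : Type*} {ℱ₀ mΩ : MeasurableSpace Ω} {P : Measure Ω}
    [IsFiniteMeasure P] {T : Ω ≃ᵐ Ω}
    (hT : MeasurePreserving T P P) (hle : ℱ₀ ≤ mΩ) {X₀ : Ω → ℝ}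
    [(lpMeas ℝ ℝ ℱ₀ 2 P).HasOrthogonalProjection] {x : Lp ℝ 2 P} (hx : x =ᵐ[P] X₀)
    (hfin : projTail P ℱ₀ (fun i ω => X₀ (iter T i ω)) 1 ≠ ∞) :
    IsometricPast.TailBound (koopman hT) (lpMeas ℝ ℝ ℱ₀ 2 P) x
      fun s => (projTail P ℱ₀ (fun i ω => X₀ (iter T i ω)) (2 ^ s)).toReal := by
  intro s N
  have hfin' : projTail P ℱ₀ (fun i ω => X₀ (iter T i ω)) (2 ^ s) ≠ ∞ :=
    ne_top_of_le_ne_top hfin (projTail_antitone _ _ Nat.one_le_two_pow)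
  rw [← ENNReal.ofReal_le_iff_le_toReal hfin',
    ENNReal.ofReal_sum_of_nonneg fun _ _ => by positivity]
  set a : ℕ → ℝ≥0∞ := fun k => eLpNorm (P[partialSum (fun i ω => X₀ (iter T i ω)) k | ℱ₀]) 2 P /
    (k : ℝ≥0∞) ^ (3 / 2 : ℝ) with ha
  have hterm : ∀ k ∈ Finset.Ico (2 ^ s) N, ENNReal.ofReal
      (‖(lpMeas ℝ ℝ ℱ₀ 2 P).starProjection (orbitSum (koopman hT) k x)‖ / (k : ℝ) ^ (3 / 2 : ℝ))
      = a k := by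
    intro k hk
    have hk0 : 0 < k := lt_of_lt_of_le (by positivity) (Finset.mem_Ico.1 hk).1
    have hk0' : (0 : ℝ) < k := by exact_mod_cast hk0
    rw [ENNReal.ofReal_div_of_pos (by positivity), ← ENNReal.ofReal_rpow_of_pos hk0',
      ENNReal.ofReal_natCast, ofReal_norm, Lp.enorm_def]
    simp only [ha]
    rw [partialSum_iter, eLpNorm_congr_ae
      (starProjection_lpMeas_coeFn hle (orbitSum_koopman_coeFn hT hx k))]
  rw [Finset.sum_congr rfl hterm]
  calc ∑ k ∈ Finset.Ico (2 ^ s) N, a k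
      ≤ ∑ k ∈ Finset.Ico (2 ^ s) N, (Set.Ici (2 ^ s)).indicator a k :=
        Finset.sum_le_sum fun k hk => by
          rw [Set.indicator_of_mem (by exact (Finset.mem_Ico.1 hk).1)]
    _ ≤ ∑' k, (Set.Ici (2 ^ s)).indicator a k := ENNReal.sum_le_tsum _
    _ = _ := (tsum_subtype (Set.Ici (2 ^ s)) a).symm

/-- The martingale approximation for processes generated by an invertible measure preserving
transformation. -/
theorem exists_isMartingaleApproximation_iter {Ω : Type*} {ℱ₀ mΩ : MeasurableSpace Ω}
    {P : Measure Ω} [IsProbabilityMeasure P] {b : ℕ → ℝ}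
    (hb_pos : ∀ n : ℕ, 1 ≤ n → 0 < b n) (hb_mono : ∀ m n : ℕ, 1 ≤ m → m ≤ n → b m ≤ b n)
    (hb_slow : SlowlyVarying b) {T : Ω ≃ᵐ Ω} (hT : MeasurePreserving T P P) (hle : ℱ₀ ≤ mΩ)
    (hℱ : ℱ₀ ≤ ℱ₀.comap T) {X₀ : Ω → ℝ} (hXm : Measurable[ℱ₀] X₀) (hX2 : MemLp X₀ 2 P)
    (hcond : ProjectiveCondition P ℱ₀ (fun i ω => X₀ (iter T i ω)) b) :
    ∃ D : ℤ → Ω → ℝ, (∀ (k : ℤ) (ω : Ω), D k ω = D 0 (iter T k ω)) ∧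
      IsMartingaleApproximation P (shiftFiltration T ℱ₀ hle hℱ)
        (fun i ω => X₀ (iter T i ω)) b D := by
  have hfact : Fact (ℱ₀ ≤ mΩ) := ⟨hle⟩
  obtain ⟨hfin, hsum⟩ := summable_dyadic_of_tsum_lt_top hb_pos hb_mono hb_slow
    (projTail_antitone (P := P) ℱ₀ (fun i ω => X₀ (iter T i ω))) hcond
  set t : ℕ → ℝ := fun s => (projTail P ℱ₀ (fun i ω => X₀ (iter T i ω)) (2 ^ s)).toReal with ht
  -- The terms `b_{2^s} t_s²` of a convergent series tend to zero and dominate `b_1 t_s²`.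
  have ht0 : Tendsto t atTop (𝓝 0) := by
    have hb1 := hb_pos 1 le_rfl
    have h1 := hsum.tendsto_atTop_zero.const_mul (b 1)⁻¹
    rw [mul_zero] at h1
    have h2 : Tendsto (fun s => t s ^ 2) atTop (𝓝 0) := by
      refine squeeze_zero (fun s => sq_nonneg _) (fun s => ?_) h1
      rw [← div_eq_inv_mul, le_div_iff₀ hb1, mul_comm]
      exact mul_le_mul_of_nonneg_right (hb_mono _ _ le_rfl Nat.one_le_two_pow) (sq_nonneg _)
    have h3 := h2.sqrt
    rw [Real.sqrt_zero] at h3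
    exact h3.congr fun s => Real.sqrt_sq ENNReal.toReal_nonneg
  set x : Lp ℝ 2 P := hX2.toLp X₀ with hx
  have hxX : x =ᵐ[P] X₀ := hX2.coeFn_toLp
  have hxK : x ∈ lpMeas ℝ ℝ ℱ₀ 2 P :=
    mem_lpMeas_iff_aestronglyMeasurable.2 ⟨X₀, hXm.stronglyMeasurable, hxX⟩
  obtain ⟨z, hzK, hz0, hzt⟩ := IsometricPast.exists_approximation
    (isometricPast_koopman hT hℱ) hxK (tailBound_of_projTail hT hle hxX hfin) ht0
  -- A strictly `ℱ₀`-measurable version of `z`, so that `D k = g ∘ T^(k+1)` is measurable for `ℱ (k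
  -- + 1)` itself and not merely up to null sets.
  obtain ⟨g, hg, hzg⟩ := mem_lpMeas_iff_aestronglyMeasurable.1 hzK
  have hgm : Measurable g := hg.measurable.mono hle le_rfl
  have hg2 : MemLp g 2 P := (memLp_congr_ae hzg).1 (Lp.memLp z)
  have hVz : koopman hT z =ᵐ[P] g ∘ T :=
    (koopman_coeFn hT z).trans (hT.quasiMeasurePreserving.ae_eq_comp hzg)
  have hgT2 : MemLp (g ∘ T) 2 P := hg2.comp_measurePreserving hT
  set D : ℤ → Ω → ℝ := fun k ω => (g ∘ T) (iter T k ω) with hD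
  have hDsucc : ∀ k, D k = g ∘ iter T (k + 1) := fun k => by
    rw [iter_add_one]; rfl
  have hmart : StationaryMartingaleDifferences P (shiftFiltration T ℱ₀ hle hℱ) D := by
    refine ⟨fun k => ?_, fun k => hgT2.comp_measurePreserving (measurePreserving_iter hT k),
      fun k => ?_, stationaryProcess_iter hT (hgm.comp T.measurable)⟩
    · rw [hDsucc]
      exact hg.measurable.comp (comap_measurable _)
    · refine (condExp_comp_comap (measurePreserving_iter hT k) hle
        (hgT2.integrable one_le_two)).trans ?_
      have h1 : P[g ∘ T | ℱ₀] =ᵐ[P] 0 := by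
        refine (starProjection_lpMeas_coeFn hle hVz).symm.trans ?_
        rw [hz0]
        exact Lp.coeFn_zero _ _ _
      exact (measurePreserving_iter hT k).quasiMeasurePreserving.ae_eq_comp h1
  refine ⟨D, fun k ω => by simp [hD, iter_zero], hmart, hmart.martingale, ?_⟩
  set y : Ω → ℝ := fun ω => X₀ ω - g (T ω) with hy
  have hym : Measurable y := (hXm.mono hle le_rfl).sub (hgm.comp T.measurable)
  have hxy : ⇑(x - koopman hT z) =ᵐ[P] y := by
    refine (Lp.coeFn_sub _ _).trans ?_
    filter_upwards [hxX, hVz] with ω h1 h2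
    rw [Pi.sub_apply, h1, h2, hy, Function.comp_apply]
  have hbp : ∀ j, 0 < b (2 ^ j) := fun j => hb_pos _ Nat.one_le_two_pow
  -- The factor `2^j` in the squared approximation bound cancels against the weight, leaving `144²
  -- b_{2^j} t_j²`.
  have hsum' : Summable fun j : ℕ =>
      b (2 ^ j) / 2 ^ j * ∫ ω, birkhoffSum T y (2 ^ j) ω ^ 2 ∂P := by
    refine Summable.of_nonneg_of_le (fun j => ?_) (fun j => ?_) (hsum.mul_left (144 ^ 2))
    · have := hbp j
      exact mul_nonneg (by positivity) (integral_nonneg fun _ => sq_nonneg _)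
    · rw [← norm_sq_eq_integral (orbitSum_koopman_coeFn hT hxy (2 ^ j))]
      have h1 := pow_le_pow_left₀ (norm_nonneg _) (hzt j) 2
      have h2 : (144 * √2 ^ j * t j) ^ 2 = 144 ^ 2 * 2 ^ j * t j ^ 2 := by
        rw [← sqrt_two_pow_mul_self]; ring
      rw [h2] at h1
      have := hbp j
      calc _ ≤ b (2 ^ j) / 2 ^ j * (144 ^ 2 * 2 ^ j * t j ^ 2) := by gcongr
        _ = _ := by simp only [ht]; field_simp
  have hlim := ae_tendsto_birkhoffSum_div_sqrt hT hym (hX2.sub hgT2) hbp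
    (inv_pos.2 (hb_pos 1 le_rfl)) (fun n hn => inv_le_bStar hb_pos hn)
    (sum_inv_dyadic_le_bStar hb_pos hb_mono) hsum'
  filter_upwards [hlim] with ω hω
  refine hω.congr fun n => ?_
  rw [partialSum_iter, hD, partialSum_iter]
  congr 1
  simp [birkhoffSum, hy, Finset.sum_sub_distrib]

end L2

/-! ### Stationary processes via the shift on path space -/

section PathSpace

variable {S : Type*} [mS : MeasurableSpace S]

/-- The shift on the space of two-sided paths. -/
def pathShift (S : Type*) [MeasurableSpace S] : (ℤ → S) ≃ᵐ (ℤ → S) where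
  toFun x k := x (k + 1)
  invFun x k := x (k - 1)
  left_inv x := by funext k; simp
  right_inv x := by funext k; simp
  measurable_toFun := measurable_pi_lambda _ fun k => measurable_pi_apply (k + 1)
  measurable_invFun := measurable_pi_lambda _ fun k => measurable_pi_apply (k - 1)

lemma pathShift_apply (x : ℤ → S) (k : ℤ) : pathShift S x k = x (k + 1) := rfl

lemma pathShift_symm_apply (x : ℤ → S) (k : ℤ) : (pathShift S).symm x k = x (k - 1) := rfl

lemma iter_pathShift_apply (m : ℤ) (x : ℤ → S) (k : ℤ) :
    iter (pathShift S) m x k = x (k + m) := by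
  induction m using Int.induction_on generalizing k with
  | zero => simp [iter_zero]
  | succ i ih =>
    rw [iter_add_one, Function.comp_apply, pathShift_apply, ih, add_right_comm, ← add_assoc]
  | pred i ih =>
    rw [iter_sub_one, Function.comp_apply, pathShift_symm_apply, ih]
    congr 1; ring

/-- The `σ`-algebra on the path space generated by the coordinates of index at most `k`. -/
@[reducible] def pathPast (S : Type*) [mS : MeasurableSpace S] (k : ℤ) : MeasurableSpace (ℤ → S) :=
  ⨆ (i : ℤ) (_ : i ≤ k), mS.comap fun x => x i

lemma pathPast_le (k : ℤ) : pathPast S k ≤ MeasurableSpace.pi :=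
  iSup₂_le fun i _ => (measurable_pi_apply i).comap_le

lemma comap_iter_pathPast (k : ℤ) :
    (pathPast S 0).comap (iter (pathShift S) k) = pathPast S k := by
  simp only [pathPast, MeasurableSpace.comap_iSup, MeasurableSpace.comap_comp]
  have hcomp : ∀ i : ℤ, (fun x : ℤ → S => x i) ∘ iter (pathShift S) k = fun x => x (i + k) :=
    fun i => by funext x; exact iter_pathShift_apply k x i
  simp only [hcomp]
  refine le_antisymm (iSup₂_le fun i hi => ?_) (iSup₂_le fun i hi => ?_)
  · exact le_iSup₂_of_le (i + k) (by omega) le_rfl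
  · exact le_iSup₂_of_le (i - k) (by omega) (by rw [sub_add_cancel])

lemma pathPast_zero_le_comap : pathPast S 0 ≤ (pathPast S 0).comap (pathShift S) := by
  have h : (pathPast S 0).comap (pathShift S) = pathPast S 1 := by
    rw [← comap_iter_pathPast 1, show (1 : ℤ) = 0 + 1 by rfl, iter_add_one, iter_zero]
    rfl
  rw [h]
  exact iSup₂_le fun i hi => le_iSup₂_of_le i (by omega) le_rfl

variable {Ω : Type*} {mΩ : MeasurableSpace Ω} {P : Measure Ω}

lemma comap_pathPast (ξ : ℤ → Ω → S) (hξ : ∀ i, Measurable (ξ i)) (k : ℤ) :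
    (pathPast S k).comap (fun ω i => ξ i ω) = pastFiltration ξ hξ k := by
  simp only [pathPast, MeasurableSpace.comap_iSup, MeasurableSpace.comap_comp]
  rfl

lemma measurePreserving_pathShift {ξ : ℤ → Ω → S} (hξ : ∀ i, Measurable (ξ i))
    (h : StationaryProcess P ξ) :
    MeasurePreserving (pathShift S) (P.map fun ω i => ξ i ω) (P.map fun ω i => ξ i ω) := by
  refine ⟨(pathShift S).measurable, ?_⟩
  rw [Measure.map_map (pathShift S).measurable (measurable_pi_lambda _ hξ)]
  exact h 1

/-- The martingale approximation for functionals of a stationary process with respect to its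
past. -/
theorem exists_isMartingaleApproximation_of_stationary [IsProbabilityMeasure P] {b : ℕ → ℝ}
    (hb_pos : ∀ n : ℕ, 1 ≤ n → 0 < b n) (hb_mono : ∀ m n : ℕ, 1 ≤ m → m ≤ n → b m ≤ b n)
    (hb_slow : SlowlyVarying b) {ξ : ℤ → Ω → S} (hξ : ∀ i, Measurable (ξ i))
    (hstat : StationaryProcess P ξ) {f : S → ℝ} (hf : MemLp f 2 (P.map (ξ 0)))
    (hcond : ProjectiveCondition P (pastFiltration ξ hξ 0) (fun i ω => f (ξ i ω)) b) :
    ∃ D : ℤ → Ω → ℝ, IsMartingaleApproximation P (pastFiltration ξ hξ)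
      (fun i ω => f (ξ i ω)) b D := by
  set Ξ : Ω → ℤ → S := fun ω i => ξ i ω with hΞ
  have hΞm : Measurable Ξ := measurable_pi_lambda _ hξ
  set P' := P.map Ξ with hP'
  have hΞp : MeasurePreserving Ξ P P' := ⟨hΞm, rfl⟩
  have hprob : IsProbabilityMeasure P' := Measure.isProbabilityMeasure_map hΞm.aemeasurable
  set T := pathShift S with hTdef
  have hT : MeasurePreserving T P' P' := measurePreserving_pathShift hξ hstat
  -- `f` is measurable only up to null sets of the marginal law; a measurable version changes the
  -- process on a single null set for all times at once.
  obtain ⟨f', hf'm, hff'⟩ := hf.1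
  have hmap : ∀ i, MeasurePreserving (ξ i) P (P.map (ξ 0)) := by
    intro i
    have he : MeasurePreserving (fun x : ℤ → S => x 0) P' (P.map (ξ 0)) :=
      ⟨measurable_pi_apply 0, by rw [hP', Measure.map_map (measurable_pi_apply 0) hΞm]; rfl⟩
    have h := (he.comp (measurePreserving_iter hT i)).comp hΞp
    convert h using 1
    funext ω
    simp [hTdef, iter_pathShift_apply, hΞ]
  set X₀ : (ℤ → S) → ℝ := fun x => f' (x 0) with hX₀
  have hX₀m : Measurable[pathPast S 0] X₀ :=
    hf'm.measurable.comp ((comap_measurable fun x : ℤ → S => x 0).mono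
      (le_iSup₂_of_le (f := fun (i : ℤ) (_ : i ≤ 0) => mS.comap fun x : ℤ → S => x i)
        0 le_rfl le_rfl) le_rfl)
  have hX₀2 : MemLp X₀ 2 P' := by
    rw [hP', memLp_map_measure_iff
      (hX₀m.mono (pathPast_le 0) le_rfl).aestronglyMeasurable hΞm.aemeasurable]
    exact ((memLp_congr_ae hff').1 hf).comp_measurePreserving (hmap 0)
  have hXi : ∀ i ω, X₀ (iter T i (Ξ ω)) = f' (ξ i ω) := fun i ω => by
    simp only [hX₀, hTdef, iter_pathShift_apply, hΞ, zero_add]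
  have hXae : ∀ᵐ ω ∂P, ∀ i, f (ξ i ω) = X₀ (iter T i (Ξ ω)) := by
    refine ae_all_iff.2 fun i => ?_
    filter_upwards [(hmap i).quasiMeasurePreserving.ae_eq_comp hff'] with ω hω
    rw [hXi]
    exact hω
  have hsumae : ∀ᵐ ω ∂P, ∀ n, partialSum (fun i ω => f (ξ i ω)) n ω =
      partialSum (fun i x => X₀ (iter T i x)) n (Ξ ω) := by
    filter_upwards [hXae] with ω hω n
    exact Finset.sum_congr rfl fun i _ => hω i
  -- The past of `ξ` is the pull-back of the past on path space, so conditional expectations, and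
  -- hence their norms, correspond under `Ξ`.
  have htail : projTail P' (pathPast S 0) (fun i x => X₀ (iter T i x)) =
      projTail P (pastFiltration ξ hξ 0) (fun i ω => f (ξ i ω)) := by
    have hk : ∀ k, eLpNorm (P'[partialSum (fun i x => X₀ (iter T i x)) k | pathPast S 0]) 2 P' =
        eLpNorm (P[partialSum (fun i ω => f (ξ i ω)) k | pastFiltration ξ hξ 0]) 2 P := by
      intro k
      have hint : Integrable (partialSum (fun i x => X₀ (iter T i x)) k) P' :=
        integrable_finsetSum (Finset.range k) (f := fun (i : ℕ) x => X₀ (iter T i x)) fun i _ =>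
          (hX₀2.comp_measurePreserving (measurePreserving_iter hT i)).integrable one_le_two
      have h1 : P[partialSum (fun i ω => f (ξ i ω)) k | pastFiltration ξ hξ 0] =ᵐ[P]
          P'[partialSum (fun i x => X₀ (iter T i x)) k | pathPast S 0] ∘ Ξ := by
        rw [← comap_pathPast ξ hξ 0]
        refine EventuallyEq.trans (condExp_congr_ae ?_) (condExp_comp_comap hΞp (pathPast_le 0) hint)
        filter_upwards [hsumae] with ω hω using hω k
      rw [eLpNorm_congr_ae h1, eLpNorm_comp_measurePreserving
        (stronglyMeasurable_condExp.mono (pathPast_le 0)).aestronglyMeasurable hΞp]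
    funext n
    simp only [projTail, hk]
  have hcond' : ProjectiveCondition P' (pathPast S 0) (fun i x => X₀ (iter T i x)) b := by
    rw [ProjectiveCondition, htail]
    exact hcond
  obtain ⟨D, -, hD, -, hlim⟩ := exists_isMartingaleApproximation_iter hb_pos hb_mono hb_slow hT
    (pathPast_le 0) pathPast_zero_le_comap hX₀m hX₀2 hcond'
  have hℱ : ∀ k, (shiftFiltration T (pathPast S 0) (pathPast_le 0) pathPast_zero_le_comap k).comap Ξ
      = pastFiltration ξ hξ k := by
    intro k
    rw [← comap_pathPast ξ hξ k, ← comap_iter_pathPast k]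
    rfl
  have hDm : ∀ k, Measurable (D k) := fun k => (hD.measurable k).mono (Filtration.le _ _) le_rfl
  have hmart : StationaryMartingaleDifferences P (pastFiltration ξ hξ) fun k ω => D k (Ξ ω) := by
    refine ⟨fun k => ?_, fun k => (hD.memLp k).comp_measurePreserving hΞp, fun k => ?_, fun m => ?_⟩
    · rw [← hℱ]
      exact (hD.measurable k).comp (comap_measurable Ξ)
    · rw [← hℱ]
      exact (condExp_comp_comap hΞp (Filtration.le _ _) ((hD.memLp k).integrable one_le_two)).trans
        (hΞp.quasiMeasurePreserving.ae_eq_comp (hD.condExp_eq_zero k))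
    · have h := hD.stationary m
      rw [hP', Measure.map_map (measurable_pi_lambda _ fun k => hDm (k + m)) hΞm,
        Measure.map_map (measurable_pi_lambda _ hDm) hΞm] at h
      exact h
  refine ⟨fun k ω => D k (Ξ ω), hmart, hmart.martingale, ?_⟩
  filter_upwards [ae_of_ae_map hΞm.aemeasurable hlim, hsumae] with ω h1 h2
  refine h1.congr fun n => ?_
  rw [h2]
  rfl

end PathSpace

end MartApprox

theorem mainTheorem2 {Ω : Type*} [mΩ : MeasurableSpace Ω] (P : Measure Ω)
    [IsProbabilityMeasure P] (b : ℕ → ℝ)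
    (hb_pos : ∀ n : ℕ, 1 ≤ n → 0 < b n)
    (hb_mono : ∀ m n : ℕ, 1 ≤ m → m ≤ n → b m ≤ b n)
    (hb_slow : MartApprox.SlowlyVarying b) :
    -- stationary Markov chains
    (∀ (S : Type*) [MeasurableSpace S] (Q : Kernel S S) [IsMarkovKernel Q]
      (ξ : ℤ → Ω → S) (hξ : ∀ i, Measurable (ξ i)) (f : S → ℝ),
      MartApprox.StationaryMarkovChain P Q ξ hξ →
      MemLp f 2 (P.map (ξ 0)) → ∫ x, f x ∂(P.map (ξ 0)) = 0 →
      MartApprox.ProjectiveCondition P (MartApprox.pastFiltration ξ hξ 0)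
        (fun i ω => f (ξ i ω)) b →
      ∃ D : ℤ → Ω → ℝ, MartApprox.IsMartingaleApproximation P (MartApprox.pastFiltration ξ hξ)
        (fun i ω => f (ξ i ω)) b D) ∧
    -- processes generated by an invertible measure preserving transformation
    (∀ (T : Ω ≃ᵐ Ω), MeasurePreserving T P P →
      ∀ (ℱ₀ : MeasurableSpace Ω) (hle : ℱ₀ ≤ mΩ) (hT : ℱ₀ ≤ ℱ₀.comap T) (X₀ : Ω → ℝ),
      Measurable[ℱ₀] X₀ → MemLp X₀ 2 P → ∫ ω, X₀ ω ∂P = 0 →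
      MartApprox.ProjectiveCondition P ℱ₀ (fun i ω => X₀ (MartApprox.iter T i ω)) b →
      ∃ D : ℤ → Ω → ℝ, (∀ (k : ℤ) (ω : Ω), D k ω = D 0 (MartApprox.iter T k ω)) ∧
        MartApprox.IsMartingaleApproximation P (MartApprox.shiftFiltration T ℱ₀ hle hT)
          (fun i ω => X₀ (MartApprox.iter T i ω)) b D) := by
  refine ⟨fun S _ Q _ ξ hξ f hchain hf _ hcond => ?_, fun T hT ℱ₀ hle hℱ X₀ hXm hX2 _ hcond => ?_⟩
  · exact MartApprox.exists_isMartingaleApproximation_of_stationary hb_pos hb_mono hb_slow hξ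
      hchain.stationary hf hcond
  · exact MartApprox.exists_isMartingaleApproximation_iter hb_pos hb_mono hb_slow hT hle hℱ hXm hX2
      hcond
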